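/- **Theorem.** For every real $d$ there is a constant $K>0$, depending only on $d$, such that the following holds. *Setting.* Let $X$ be a metric space of doubling dimension at most $d$ (every ball can be covered by at most $2^d$ balls of half its radius). Let $k\ge 1$, $z\ge 0$ be integers, $0<\varepsilon<1$, $W>0$ and $0<\Delta_{\min}\le\Delta_{\max}$, and put $\sigma=\Delta_{\max}/\Delta_{\min}$. Let $A\subseteq X$ be the set of admissible ball centers (for instance $A=X$, or $A$ = the set of points of the stream); any two distinct points of $A$ have distance at least $\Delta_{\min}$. Let $p_0,p_1,\dots$ be a finite or infinite stream of points of $A$ with pairwise distances at most $\Delta_{\max}$, arriving at strictly increasing times $t_{\mathrm{arr}}(p_i)\ge 0$, only finitely many before any given time. Put $t_{\mathrm{exp}}(p_i)=t_{\mathrm{arr}}(p_i)+W$ and $P(t)=\{p_i : t_{\mathrm{arr}}(p_i)\le t<t_{\mathrm{exp}}(p_i)\}$ (a multiset). For a finite multiset $Q$, a solution consists of $k$ balls of equal radius with centers in $A$ that cover all points of $Q$ except at most $z$ outliers, and $\mathrm{opt}_{k,z}(Q)$ is the smallest radius of a solution. Let a subroutine *solve* be given that computes an optimal solution for any finite multiset,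 and let *approx* be either the greedy algorithm of Charikar et al. for this problem or any other algorithm that computes a solution of radius at most $3\,\mathrm{opt}_{k,z}(Q)$. (The greedy algorithm finds the smallest $r$, among $0$ and the distances from points of $A$ to points of $Q$, for which the following leaves at most $z$ points uncovered: $k$ times, choose a ball of radius $r$ with center in $A$ that contains the most uncovered points, and mark all points in the concentric ball of radius $3r$ as covered. It reports the $k$ balls of radius $3r$.) *Decision sketch.* For $\rho,\eta>0$ the sketch $\Gamma_{\rho,\eta}(t)$ consists of a timestamp $\tau$, a set $\mathcal B$ of mini-balls of radius $\eta\rho$ centered at stream points, a representative set $R(B)$ for each $B\in\mathcal B$, and a set $P_{\mathrm{out}}$. Initially $\tau=0$ and all sets are empty. Its storage is the number of items it stores: the timestamp, the centers, the representatives and the points of $P_{\mathrm{out}}$. - *Departure.* A point that expires is deleted from the set $R(B)$ or $P_{\mathrm{out}}$ containing it; if $R(B)$ becomes empty by this, $B$ is deleted. - *Arrival of $p$.* (1) If $p$ lies in a mini-ball $B$, add it to $R(B)$ for one such $B$; otherwise add it to $P_{\mathrm{out}}$. (2) Let $Q=P_{\mathrm{out}}\cup\bigcup_B R(B)$, let $Q_i$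 be its $i$ newest points, let $i^*\le|Q|$ be the largest index for which *approx* on $Q_{i^*}$ reports balls of radius at most $6\rho$, and let $\mathcal B^*$ be these balls. (3) If $Q_{i^*}\ne Q$, set $\tau:=\max(\tau,t_{\mathrm{exp}}(q))$, where $q$ is the newest point of $Q\setminus Q_{i^*}$; delete the points of $Q\setminus Q_{i^*}$ from all representative sets. (4) Increase the radii of the balls in $\mathcal B^*$ by $\eta\rho$, and keep the mini-balls (with their representative sets) whose center lies in an expanded ball. Let $Z$ be the set of points of $Q_{i^*}$ in no kept representative set and $Z_{\mathrm{in}}$ the set of those in an expanded ball. Treat the points $q\in Z_{\mathrm{in}}$ one by one, in any order: add $q$ to $R(B)$ for some current mini-ball $B\ni q$ if there is one, otherwise create a mini-ball with center $q$ and representative set $\{q\}$. Then reduce each $R(B)$ to its $z+1$ newest points if it is larger, and set $P_{\mathrm{out}}:=Z\setminus Z_{\mathrm{in}}$. *TryToCover*$(\Gamma_{\rho,\eta}(t))$: let $S(t)=P_{\mathrm{out}}\cup\bigcup_B R(B)$ and let $\mathcal C$ be the output of *solve* on $S(t)$. If $t<\tau$ or $\mathrm{opt}_{k,z}(S(t))>2\rho$,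 report NO; otherwise increase the radius of the balls of $\mathcal C$ by $2\eta\rho$ and report them. *The sketch $\Gamma(t)$* consists of $\Gamma_{\rho_i,\varepsilon/2}(t)$ with $\rho_i=2^i\Delta_{\min}$ for $0\le i\le\lfloor\log_2\sigma\rfloor$. *FindApproximateCenters*$(\Gamma(t))$ runs TryToCover on $\Gamma_{\rho_0,\varepsilon/2}(t),\Gamma_{\rho_1,\varepsilon/2}(t),\dots$ until the answer is not NO, reduces the radius of the balls in this answer to zero if it is less than $\Delta_{\min}$, and reports them. *Claim.* Whatever arbitrary choices are made, for every time $t\ge 0$: 1. $\Gamma(t)$ uses at most $K\cdot\dfrac{k(z+1)}{\varepsilon^d}\cdot(1+\log_2\sigma)$ storage; 2. FindApproximateCenters$(\Gamma(t))$ does report an answer, namely $k$ balls (of equal radius, with centers in $A$) of radius at most $(1+\varepsilon)\cdot\mathrm{opt}_{k,z}(P(t))$ that cover all points of $P(t)$ except at most $z$ outliers. -/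

import Mathlib

universe u

noncomputable section

open scoped Classical

namespace KCenter

/-! ### The metric space and the static problem -/

/-- The doubling dimension of `X` is at most `d`: every ball can be covered by at most `2 ^ d`
balls of half its radius. -/
def DoublingDimLE (X : Type u) [MetricSpace X] (d : ℝ) : Prop :=
  ∀ (x : X) (r : ℝ), 0 < r → ∃ F : Finset X, (F.card : ℝ) ≤ (2 : ℝ) ^ d ∧
    Metric.closedBall x r ⊆ ⋃ y ∈ F, Metric.closedBall y (r / 2)

/-- A collection of `k` congruent (closed) balls. -/
structure Balls (X : Type u) (k : ℕ) where
  center : Fin k → X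
  radius : ℝ

variable {X : Type u} [MetricSpace X] {k : ℕ}

/-- `x` lies in the union of the balls after their radii have been increased by `e`. -/
def Balls.CoversWithin (C : Balls X k) (e : ℝ) (x : X) : Prop :=
  ∃ j, dist x (C.center j) ≤ C.radius + e

/-- The balls in `C` are centred at points of `A` and cover all points of the multiset `Q`, except
for at most `z` outliers (counted with multiplicity). -/
def IsSolution (A : Set X) (z : ℕ) (Q : Multiset X) (C : Balls X k) : Prop :=
  0 ≤ C.radius ∧ (∀ j, C.center j ∈ A) ∧ Q.countP (fun x => ¬ C.CoversWithin 0 x) ≤ z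

/-- The optimal radius for the `k`-center problem with `z` outliers on the multiset `Q`, where the
balls are centred at points of `A`. -/
def opt (A : Set X) (k z : ℕ) (Q : Multiset X) : ℝ :=
  sInf {r | ∃ C : Balls X k, IsSolution A z Q C ∧ C.radius = r}

/-- `C` is an optimal solution for `Q`. -/
def IsOptimal (A : Set X) (z : ℕ) (Q : Multiset X) (C : Balls X k) : Prop :=
  IsSolution A z Q C ∧ ∀ C' : Balls X k, IsSolution A z Q C' → C.radius ≤ C'.radius

/-- `C` is a `c`-approximate solution for `Q`. -/
def IsApprox (A : Set X) (z : ℕ) (c : ℝ) (Q : Multiset X) (C : Balls X k) : Prop :=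
  IsSolution A z Q C ∧ C.radius ≤ c * opt A k z Q

/-! ### The greedy algorithm of Charikar et al. for the static problem -/

/-- `pick` selects, for every multiset `U` of points that are still uncovered, a centre in `A`
whose ball of radius `r` contains as many points of `U` as possible. -/
def IsGreedyRule (A : Set X) (r : ℝ) (pick : Multiset X → X) : Prop :=
  ∀ U : Multiset X, pick U ∈ A ∧ ∀ a ∈ A,
    U.countP (fun x => dist x a ≤ r) ≤ U.countP (fun x => dist x (pick U) ≤ r)

/-- The points that are still uncovered after `m` greedy rounds; in each round all points in the
ball of radius `3 * r` around the selected centre become covered. -/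
def greedyLeft (pick : Multiset X → X) (r : ℝ) (Q : Multiset X) : ℕ → Multiset X
  | 0 => Q
  | m + 1 => (greedyLeft pick r Q m).filter
      (fun x => 3 * r < dist x (pick (greedyLeft pick r Q m)))

/-- The expanded balls selected in `k` greedy rounds. -/
def greedyBalls (k : ℕ) (pick : Multiset X → X) (r : ℝ) (Q : Multiset X) : Balls X k where
  center := fun j => pick (greedyLeft pick r Q j)
  radius := 3 * r

/-- The radii that are tried: zero, and the distances between centres and points. -/
def candidateRadii (A : Set X) (Q : Multiset X) : Set ℝ :=
  {r | r = 0 ∨ ∃ a ∈ A, ∃ x ∈ Q, r = dist x a}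

/-- `C` is an output on `Q` of the greedy algorithm: for some way of breaking ties among best
centres, it consists of the expanded balls for the smallest candidate radius at which the greedy
selection leaves at most `z` points uncovered. -/
def IsCharikarOutput (A : Set X) (z : ℕ) (Q : Multiset X) (C : Balls X k) : Prop :=
  ∃ pick : ℝ → Multiset X → X, (∀ r, IsGreedyRule A r (pick r)) ∧
    ∃ r, IsLeast {r | r ∈ candidateRadii A Q ∧
        Multiset.card (greedyLeft (pick r) r Q k) ≤ z} r ∧
      C = greedyBalls k (pick r) r Q

/-! ### Streams -/

/-- A finite or infinite stream. Its elements are the indices `i < len`; the element `i` is a point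
`pt i` that arrives at time `arr i`. The same point may occur several times. Elements are numbered
by arrival time, and only finitely many of them arrive before any given time. -/
structure PointStream (X : Type u) where
  len : ℕ∞
  pt : ℕ → X
  arr : ℕ → ℝ
  arr_nonneg : ∀ i : ℕ, (i : ℕ∞) < len → 0 ≤ arr i
  arr_lt : ∀ i j : ℕ, i < j → (j : ℕ∞) < len → arr i < arr j
  finite_arrived : ∀ t : ℝ, {i : ℕ | (i : ℕ∞) < len ∧ arr i ≤ t}.Finite

namespace PointStream

/-- The expiration time of an element, for windows of length `W`. -/
def exp (S : PointStream X) (W : ℝ) (i : ℕ) : ℝ := S.arr i + W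

/-- The elements that arrived at time `t` or earlier. -/
def arrived (S : PointStream X) (t : ℝ) : Finset ℕ := (S.finite_arrived t).toFinset

/-- The elements in the window at time `t`. -/
def window (S : PointStream X) (W t : ℝ) : Finset ℕ :=
  (S.arrived t).filter (fun i => t < S.exp W i)

/-- The multiset of points of a set of stream elements. -/
def points (S : PointStream X) (Q : Finset ℕ) : Multiset X := Q.val.map S.pt

end PointStream

/-- The `i` newest elements of `Q` (all of `Q` if it has fewer than `i` elements). -/
def newest (i : ℕ) (Q : Finset ℕ) : Finset ℕ :=
  Q.filter (fun a => (Q.filter (fun b => a < b)).card < i)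

/-! ### The sketch for the decision problem -/

/-- A collection of mini-balls, given by the stream elements that are their centres, with their
representative sets. Only the values of `rep` on `centers` are relevant. -/
structure MiniBalls where
  centers : Finset ℕ
  rep : ℕ → Finset ℕ

/-- The sketch: a timestamp, mini-balls with their representative sets, and a set of outliers. -/
structure Sketch extends MiniBalls where
  τ : ℝ
  out : Finset ℕ

/-- All representatives. -/
def MiniBalls.reps (M : MiniBalls) : Finset ℕ := M.centers.biUnion M.rep

/-- All stream elements in the sketch that may be used as representatives or outliers. -/
def Sketch.elems (Γ : Sketch) : Finset ℕ := Γ.reps ∪ Γ.out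

/-- The storage: the timestamp, the centres of the mini-balls, all representatives and all
outliers. -/
def Sketch.storage (Γ : Sketch) : ℕ :=
  1 + Γ.centers.card + ∑ b ∈ Γ.centers, (Γ.rep b).card + Γ.out.card

/-- The sketch before the first arrival. -/
def Sketch.init : Sketch where
  centers := ∅
  rep := fun _ => ∅
  τ := 0
  out := ∅

/-- The arbitrary choices of the algorithm: while the arrival of element `j` is handled, `order j`
is the order in which a set of elements is traversed, and `pick j q F` is the mini-ball that
element `q` is assigned to, when `F` is the set of mini-balls that contain it. -/
structure TieBreak where
  order : ℕ → Finset ℕ → List ℕ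
  pick : ℕ → ℕ → Finset ℕ → ℕ
  order_nodup : ∀ j F, (order j F).Nodup
  order_toFinset : ∀ j F, (order j F).toFinset = F
  pick_mem : ∀ j q F, F.Nonempty → pick j q F ∈ F

/-- The mini-balls of radius `r` that contain element `q`. -/
def MiniBalls.containing (M : MiniBalls) (S : PointStream X) (r : ℝ) (q : ℕ) : Finset ℕ :=
  M.centers.filter (fun b => dist (S.pt q) (S.pt b) ≤ r)

/-- Add `q` to the representative set of the mini-ball with centre `b`. -/
def MiniBalls.addRep (M : MiniBalls) (b q : ℕ) : MiniBalls where
  centers := M.centers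
  rep := Function.update M.rep b (insert q (M.rep b))

/-- Create a mini-ball with centre `q` and representative set `{q}`. -/
def MiniBalls.create (M : MiniBalls) (q : ℕ) : MiniBalls where
  centers := insert q M.centers
  rep := Function.update M.rep q {q}

/-- Add `q` to the representative set of a mini-ball that contains it, if there is one; otherwise
create a mini-ball with centre `q`. -/
def MiniBalls.assign (S : PointStream X) (tb : TieBreak) (r : ℝ) (j : ℕ) (M : MiniBalls) (q : ℕ) :
    MiniBalls :=
  if (M.containing S r q).Nonempty then M.addRep (tb.pick j q (M.containing S r q)) q
  else M.create q

/-- Departures: delete all elements that have expired at time `t`, and delete each mini-ball whose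
representative set becomes empty by this. -/
def Sketch.expire (S : PointStream X) (W t : ℝ) (Γ : Sketch) : Sketch where
  centers := Γ.centers.filter
    (fun b => Γ.rep b = ∅ ∨ ((Γ.rep b).filter (fun i => t < S.exp W i)).Nonempty)
  rep := fun b => (Γ.rep b).filter (fun i => t < S.exp W i)
  τ := Γ.τ
  out := Γ.out.filter (fun i => t < S.exp W i)

/-- First step of an arrival: add `j` to the representative set of a mini-ball (of radius `r`) that
contains it or, if there is none, to the outliers. -/
def Sketch.insertNew (S : PointStream X) (tb : TieBreak) (r : ℝ) (Γ : Sketch) (j : ℕ) : Sketch :=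
  if (Γ.containing S r j).Nonempty then
    { Γ with toMiniBalls := Γ.addRep (tb.pick j j (Γ.containing S r j)) j }
  else { Γ with out := insert j Γ.out }

/-- Second step of an arrival: the largest `i` such that the static subroutine `approx` reports
balls of radius at most `6 * ρ` on the `i` newest elements of `Q`. -/
def keepCount (S : PointStream X) (approx : Multiset X → Balls X k) (ρ : ℝ) (Q : Finset ℕ) : ℕ :=
  Nat.findGreatest (fun i => (approx (S.points (newest i Q))).radius ≤ 6 * ρ) Q.card

/-- Third step of an arrival, the timestamp: if not all of `Q` is kept, then the timestamp becomes
at least the expiration time of the newest element that is not kept. -/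
def newTimestamp (S : PointStream X) (W τ : ℝ) (Q kept : Finset ℕ) : ℝ :=
  if h : (Q \ kept).Nonempty then max τ (S.exp W ((Q \ kept).max' h)) else τ

/-- Fourth step of an arrival: given the mini-balls `M`, the set `kept` of elements that are kept,
and the balls `B` reported for them, compute the new mini-balls, their representative sets and
the new outliers. -/
def rebuild (S : PointStream X) (tb : TieBreak) (z : ℕ) (ρ ε τ : ℝ) (j : ℕ) (M : MiniBalls)
    (kept : Finset ℕ) (B : Balls X k) : Sketch :=
  let M₀ : MiniBalls :=
    { centers := M.centers.filter (fun b => B.CoversWithin (ε * ρ) (S.pt b))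
      rep := fun b => M.rep b ∩ kept }
  let Z : Finset ℕ := kept \ M₀.reps
  let Zin : Finset ℕ := Z.filter (fun q => B.CoversWithin (ε * ρ) (S.pt q))
  let M₁ : MiniBalls := (tb.order j Zin).foldl (MiniBalls.assign S tb (ε * ρ) j) M₀
  { centers := M₁.centers
    rep := fun b => newest (z + 1) (M₁.rep b)
    τ := τ
    out := Z \ Zin }

/-- Handling the arrival of element `j`. -/
def Sketch.arrive (S : PointStream X) (W : ℝ) (z : ℕ) (approx : Multiset X → Balls X k)
    (tb : TieBreak) (ρ ε : ℝ) (Γ : Sketch) (j : ℕ) : Sketch :=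
  let Γ₁ := Γ.insertNew S tb (ε * ρ) j
  let Q := Γ₁.elems
  let kept := newest (keepCount S approx ρ Q) Q
  rebuild S tb z ρ ε (newTimestamp S W Γ.τ Q kept) j Γ₁.toMiniBalls kept (approx (S.points kept))

/-- The sketch right after the `n`-th arrival. -/
def sketchAfter (S : PointStream X) (W : ℝ) (z : ℕ) (approx : Multiset X → Balls X k)
    (tb : TieBreak) (ρ ε : ℝ) : ℕ → Sketch
  | 0 => Sketch.init
  | n + 1 => ((sketchAfter S W z approx tb ρ ε n).expire S W (S.arr n)).arrive
      S W z approx tb ρ ε n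

/-- The sketch at time `t`, after all arrivals and departures up to and including time `t`. -/
def sketchAt (S : PointStream X) (W : ℝ) (z : ℕ) (approx : Multiset X → Balls X k)
    (tb : TieBreak) (ρ ε t : ℝ) : Sketch :=
  (sketchAfter S W z approx tb ρ ε (S.arrived t).card).expire S W t

/-- The decision algorithm at time `t`, using a static subroutine `solve`; `none` means "no". -/
def tryToCover (S : PointStream X) (solve : Multiset X → Balls X k) (ρ ε t : ℝ) (Γ : Sketch) :
    Option (Balls X k) :=
  let C := solve (S.points Γ.elems)
  if t < Γ.τ ∨ 2 * ρ < C.radius then none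
  else some { C with radius := C.radius + 2 * ε * ρ }

/-! ### The sketch for the optimization problem -/

/-- The index of the last decision sketch, `⌊log₂ (Δmax / Δmin)⌋`. -/
def lastIndex (Δmin Δmax : ℝ) : ℕ := ⌊Real.logb 2 (Δmax / Δmin)⌋₊

/-- The parameter `ρᵢ = 2ⁱ Δmin`. -/
def rho (Δmin : ℝ) (i : ℕ) : ℝ := 2 ^ i * Δmin

/-- The sketch for the optimization problem at time `t`: its `i`-th component, for
`i ≤ lastIndex Δmin Δmax`, is the decision sketch with parameters `ρᵢ` and `ε / 2`. -/
def fullSketch (S : PointStream X) (W : ℝ) (z : ℕ) (approx : Multiset X → Balls X k)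
    (tb : TieBreak) (ε Δmin t : ℝ) (i : ℕ) : Sketch :=
  sketchAt S W z approx tb (rho Δmin i) (ε / 2) t

/-- The total storage of the decision sketches `Γ 0, …, Γ L`. -/
def totalStorage (L : ℕ) (Γ : ℕ → Sketch) : ℕ := ∑ i ∈ Finset.range (L + 1), (Γ i).storage

/-- The decision algorithm is run on `Γ 0`, `Γ 1`, … until its answer is not "no"; if the radius of
the balls in this answer is less than `Δmin`, then it is reduced to zero. The value is `none` only
if all answers for `Γ 0, …, Γ L` are "no". -/
def findApproximateCenters (S : PointStream X) (solve : Multiset X → Balls X k)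
    (ε Δmin t : ℝ) (L : ℕ) (Γ : ℕ → Sketch) : Option (Balls X k) :=
  ((List.range (L + 1)).findSome? (fun i => tryToCover S solve (rho Δmin i) (ε / 2) t (Γ i))).map
    (fun C => if C.radius < Δmin then { C with radius := 0 } else C)

end KCenter

end

noncomputable section

open scoped Classical

namespace KCenter

/-! ### The static problem: optimal radius and monotonicity. -/

section Static

/-! The proof rests on the invariant `Sketch.Valid` of the decision sketch. An unexpired element
that outlives `τ` is either stored or `Saturated`, with at least `z + 1` newer representatives in a
mini-ball around it. A solution for the stored elements cannot leave all of these as outliers, so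
one of its balls meets the mini-ball, and two further mini-ball radii reach the missing element
(`Sketch.Valid.isSolution_expand`). The same pigeonhole, applied to the balls of `approx`, shows
that a mini-ball vouching for a missing element survives a rebuild as long as its representatives
are kept (`isRebuilt_rebuild`). Being newer, the representatives do not expire before the elements
they stand for.

The answer NO is always justified (`Sketch.Valid.lt_opt_of_tryToCover_eq_none`). A nonzero `τ` comes
with elements that live at least until `τ` and whose optimum exceeds `2 * ρ`, because a
3-approximation exceeded `6 * ρ` on them; while `t < τ` they all lie in the window. Otherwise the
stored elements, a subset of the window, already have a large optimum.

For the storage, centres of mini-balls are more than `ε * ρ` apart but within `(6 + ε) * ρ` of `k`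
points, and repeated halving in a doubling space bounds their number by `k * (28 / ε) ^ d`.

For the approximation factor, take the first scale that answers. If it is not scale 0, the NO of its
predecessor shows that its `ρ` is below the optimum, so the additive error, `ε * ρ` for sketches run
with `ε / 2`, is at most `ε` times the optimum. Scale 0 is settled by the minimum distance `Δmin`.
The last scale cannot say NO, since twice its `ρ` exceeds `Δmax`. The greedy algorithm enters only
as a 3-approximation (`IsCharikarOutput.isApprox`). -/

theorem countP_le_countP_of_imp {X : Type*} {Q : Multiset X} {p q : X → Prop}
    [DecidablePred p] [DecidablePred q] (h : ∀ x ∈ Q, p x → q x) :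
    Q.countP p ≤ Q.countP q := by
  rw [Multiset.countP_eq_card_filter, Multiset.countP_eq_card_filter]
  refine Multiset.card_le_card ?_
  rw [Multiset.le_filter]
  refine ⟨Multiset.filter_le _ _, fun x hx => ?_⟩
  rw [Multiset.mem_filter] at hx
  exact h x hx.1 hx.2

variable {X : Type u} [MetricSpace X] {k : ℕ} {A : Set X} {z : ℕ} {Q Q' : Multiset X}
  {C : Balls X k}

theorem opt_nonneg (A : Set X) (k z : ℕ) (Q : Multiset X) : 0 ≤ opt A k z Q :=
  Real.sInf_nonneg (by rintro _ ⟨C, hC, rfl⟩; exact hC.1)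

theorem IsSolution.opt_le (h : IsSolution A z Q C) : opt A k z Q ≤ C.radius :=
  csInf_le ⟨0, by rintro _ ⟨C, hC, rfl⟩; exact hC.1⟩ ⟨C, h, rfl⟩

theorem IsSolution.mono (h : IsSolution A z Q' C) (hQ : Q ≤ Q') : IsSolution A z Q C :=
  ⟨h.1, h.2.1, (Multiset.countP_le_of_le _ hQ).trans h.2.2⟩

/-- A solution for the larger multiset is required: without one its optimum would be `sInf ∅ = 0`.
-/
theorem IsSolution.opt_mono (h : IsSolution A z Q' C) (hQ : Q ≤ Q') :
    opt A k z Q ≤ opt A k z Q' := by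
  refine le_csInf ⟨_, C, h, rfl⟩ ?_
  rintro _ ⟨C', hC', rfl⟩
  exact (hC'.mono hQ).opt_le

theorem IsOptimal.radius_eq (h : IsOptimal A z Q C) : C.radius = opt A k z Q := by
  refine le_antisymm (le_csInf ⟨_, C, h.1, rfl⟩ ?_) h.1.opt_le
  rintro _ ⟨C', hC', rfl⟩
  exact h.2 C' hC'

/-- If distinct admissible centres have distance at least `δ`, then balls of radius less than `δ`
can be shrunk to points. -/
theorem IsSolution.shrink {δ : ℝ} (hA : ∀ x ∈ A, ∀ y ∈ A, x ≠ y → δ ≤ dist x y)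
    (hQ : ∀ x ∈ Q, x ∈ A) (h : IsSolution A z Q C) (hr : C.radius < δ) :
    IsSolution A z Q { C with radius := 0 } := by
  refine ⟨le_rfl, h.2.1, le_trans (countP_le_countP_of_imp ?_) h.2.2⟩
  rintro x hx hn ⟨j, hj⟩
  refine hn ⟨j, ?_⟩
  have : x = C.center j := by
    by_contra hne
    have := hA x (hQ x hx) _ (h.2.1 j) hne
    linarith
  simp [this]

theorem IsOptimal.radius_eq_zero_or_le {δ : ℝ} (hA : ∀ x ∈ A, ∀ y ∈ A, x ≠ y → δ ≤ dist x y)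
    (hQ : ∀ x ∈ Q, x ∈ A) (h : IsOptimal A z Q C) : C.radius = 0 ∨ δ ≤ C.radius := by
  by_contra! hcon
  exact hcon.1 (le_antisymm (h.2 _ (h.1.shrink hA hQ hcon.2)) h.1.1)

/-! ### The greedy algorithm is a 3-approximation. -/

/-- Identifies the greedy leftover with the outliers of the reported balls. -/
theorem greedyLeft_eq_filter (pick : Multiset X → X) (r : ℝ) (Q : Multiset X) (m : ℕ) :
    greedyLeft pick r Q m =
      Q.filter (fun x => ∀ j < m, 3 * r < dist x (pick (greedyLeft pick r Q j))) := by
  induction m with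
  | zero => simp [greedyLeft]
  | succ m ih =>
    conv_lhs => rw [greedyLeft]
    conv_lhs => arg 2; rw [ih]
    rw [Multiset.filter_filter]
    refine Multiset.filter_congr fun x _ => ?_
    rw [Nat.forall_lt_succ_right, and_comm]

/-- The greedy selection with a radius for which a solution exists covers sufficiently many
points: after `m` rounds, the points that are neither covered by the selected expanded balls nor
by some `k - m` balls of the solution are at most `z` in number. -/
theorem exists_card_greedyLeft_le {pick : Multiset X → X} (hC : IsSolution A z Q C)
    (hpick : IsGreedyRule A C.radius pick) {m : ℕ} (hm : m ≤ k) :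
    ∃ J : Finset (Fin k), J.card = k - m ∧
      (greedyLeft pick C.radius Q m).countP
        (fun x => ∀ j ∈ J, C.radius < dist x (C.center j)) ≤ z := by
  induction m with
  | zero =>
    refine ⟨Finset.univ, by simp, le_trans (countP_le_countP_of_imp ?_) hC.2.2⟩
    rintro x - hx ⟨j, hj⟩
    have := hx j (Finset.mem_univ _)
    linarith
  | succ m ih =>
    obtain ⟨J, hJ, hle⟩ := ih (by omega)
    set r := C.radius with hr
    set U := greedyLeft pick r Q m with hU
    set g := pick U with hg
    have hgreedy := hpick U
    have hsucc : greedyLeft pick r Q (m + 1) = U.filter (fun x => 3 * r < dist x g) := rfl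
    have hJpos : J.Nonempty := by
      rw [← Finset.card_pos]; omega
    have hcard : ∀ j ∈ J, (J.erase j).card = k - (m + 1) := by
      intro j hj
      rw [Finset.card_erase_of_mem hj, hJ, Nat.sub_sub]
    have hr0 : 0 ≤ r := hC.1
    -- If the greedy ball shares an uncovered point with a remaining solution ball, its threefold
    -- expansion swallows that ball, which can be dropped from `J`.
    by_cases hcase : ∃ j ∈ J, ∃ x ∈ U, dist x g ≤ r ∧ dist x (C.center j) ≤ r
    · obtain ⟨j, hj, x, hx, hxg, hxj⟩ := hcase
      refine ⟨J.erase j, hcard j hj, le_trans ?_ hle⟩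
      rw [hsucc, Multiset.countP_filter]
      refine countP_le_countP_of_imp ?_
      rintro y - ⟨hy, hyg⟩ i hi
      by_cases hij : i = j
      · subst hij
        by_contra! hcon
        have h1 := dist_triangle y (C.center i) g
        have h2 := dist_triangle (C.center i) x g
        rw [dist_comm (C.center i) x] at h2
        linarith
      · exact hy i (Finset.mem_erase.2 ⟨hij, hi⟩)
    -- Otherwise any remaining ball may be dropped: greedy optimality charges its points to those in
    -- the greedy ball, which lie outside all balls of `J` and so were already counted as outliers.
    · push Not at hcase
      obtain ⟨j, hj⟩ := hJpos
      refine ⟨J.erase j, hcard j hj, le_trans ?_ hle⟩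
      rw [hsucc, Multiset.countP_filter]
      have hbest : U.countP (fun x => dist x (C.center j) ≤ r) ≤ U.countP (fun x => dist x g ≤ r) :=
        hgreedy.2 (C.center j) (hC.2.1 j)
      have h1 : U.countP (fun x => (∀ i ∈ J.erase j, r < dist x (C.center i)) ∧ 3 * r < dist x g)
          ≤ U.countP (fun x => (∀ i ∈ J, r < dist x (C.center i)) ∧ r < dist x g)
            + U.countP (fun x => dist x (C.center j) ≤ r) := by
        rw [Multiset.countP_eq_card_filter, Multiset.countP_eq_card_filter,
          Multiset.countP_eq_card_filter, ← Multiset.card_add]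
        rw [Multiset.filter_add_filter, Multiset.card_add]
        refine le_trans (Multiset.card_le_card ?_) (Nat.le_add_right _ _)
        rw [Multiset.le_filter]
        refine ⟨Multiset.filter_le _ _, fun x hx => ?_⟩
        rw [Multiset.mem_filter] at hx
        obtain ⟨-, hx1, hx2⟩ := hx
        by_cases hxj : dist x (C.center j) ≤ r
        · exact Or.inr hxj
        · refine Or.inl ⟨fun i hi => ?_, by linarith⟩
          by_cases hij : i = j
          · subst hij; exact not_le.1 hxj
          · exact hx1 i (Finset.mem_erase.2 ⟨hij, hi⟩)
      have h2 : U.countP (fun x => (∀ i ∈ J, r < dist x (C.center i)) ∧ r < dist x g)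
            + U.countP (fun x => dist x g ≤ r)
          ≤ U.countP (fun x => ∀ i ∈ J, r < dist x (C.center i)) := by
        rw [Multiset.countP_eq_card_filter, Multiset.countP_eq_card_filter,
          Multiset.countP_eq_card_filter, ← Multiset.card_add, Multiset.filter_add_filter]
        have h0 : U.filter (fun x => ((∀ i ∈ J, r < dist x (C.center i)) ∧ r < dist x g) ∧
            dist x g ≤ r) = 0 := by
          rw [Multiset.filter_eq_nil]
          rintro x - ⟨⟨-, h⟩, h'⟩
          linarith
        rw [h0, add_zero]
        refine Multiset.card_le_card ?_
        rw [Multiset.le_filter]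
        refine ⟨Multiset.filter_le _ _, fun x hx => ?_⟩
        rw [Multiset.mem_filter] at hx
        obtain ⟨hxU, hx1 | hx1⟩ := hx
        · exact hx1.1
        · exact fun i hi => hcase i hi x hxU hx1
      omega

theorem card_greedyLeft_le {pick : Multiset X → X} (hC : IsSolution A z Q C)
    (hpick : IsGreedyRule A C.radius pick) :
    Multiset.card (greedyLeft pick C.radius Q k) ≤ z := by
  obtain ⟨J, hJ, h⟩ := exists_card_greedyLeft_le hC hpick le_rfl
  have : J = ∅ := by rw [← Finset.card_eq_zero]; omega
  subst this
  simpa using h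

/-- The radius of a solution can be reduced to a candidate radius. -/
theorem IsSolution.exists_candidate (h : IsSolution A z Q C) :
    ∃ r ∈ candidateRadii A Q, r ≤ C.radius ∧ IsSolution A z Q { C with radius := r } := by
  -- The maximum of `T` works: every point-centre distance up to `C.radius` belongs to `T`, so no
  -- covered point is lost. The element `0` keeps `T` nonempty.
  set T : Finset ℝ := insert 0 (((Finset.univ ×ˢ Q.toFinset).image
    (fun p : Fin k × X => dist p.2 (C.center p.1))).filter (fun r => r ≤ C.radius)) with hT
  have hne : T.Nonempty := ⟨0, Finset.mem_insert_self _ _⟩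
  have hmem := T.max'_mem hne
  have hmax : ∀ r ∈ T, r ≤ T.max' hne := fun r hr => T.le_max' r hr
  refine ⟨T.max' hne, ?_, ?_, hmax 0 (Finset.mem_insert_self _ _), h.2.1,
    le_trans (countP_le_countP_of_imp ?_) h.2.2⟩
  · rw [Finset.mem_insert, Finset.mem_filter, Finset.mem_image] at hmem
    rcases hmem with h0 | ⟨⟨⟨j, x⟩, hp, h1⟩, -⟩
    · exact Or.inl h0
    · rw [Finset.mem_product] at hp
      exact Or.inr ⟨_, h.2.1 j, x, Multiset.mem_toFinset.1 hp.2, h1.symm⟩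
  · rw [Finset.mem_insert, Finset.mem_filter] at hmem
    rcases hmem with h0 | h1
    · exact h0.trans_le h.1
    · exact h1.2
  · rintro x hx hn ⟨j, hj⟩
    refine hn ⟨j, ?_⟩
    rw [add_zero] at hj ⊢
    refine hmax _ (Finset.mem_insert_of_mem (Finset.mem_filter.2 ⟨?_, hj⟩))
    exact Finset.mem_image.2 ⟨(j, x), Finset.mem_product.2
      ⟨Finset.mem_univ _, Multiset.mem_toFinset.2 hx⟩, rfl⟩

/-- Success of greedy need not be monotone in the radius: every solution can be shrunk to a
candidate radius at which greedy succeeds, and the reported candidate is the least such. -/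
theorem IsCharikarOutput.isApprox (h : IsCharikarOutput A z Q C) : IsApprox A z 3 Q C := by
  obtain ⟨pick, hpick, r, ⟨⟨hr, hcard⟩, hleast⟩, rfl⟩ := h
  have hr0 : 0 ≤ r := by
    rcases hr with rfl | ⟨a, -, x, -, rfl⟩
    · exact le_rfl
    · exact dist_nonneg
  have hsol : IsSolution A z Q (greedyBalls k (pick r) r Q) := by
    refine ⟨by simp only [greedyBalls]; linarith, fun j => (hpick r _).1, ?_⟩
    rw [greedyLeft_eq_filter, ← Multiset.countP_eq_card_filter] at hcard
    refine le_trans (countP_le_countP_of_imp ?_) hcard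
    intro x _ hx j hj
    by_contra! hcon
    exact hx ⟨⟨j, hj⟩, by simpa [greedyBalls] using hcon⟩
  refine ⟨hsol, ?_⟩
  have : r ≤ opt A k z Q := by
    refine le_csInf ⟨_, _, hsol, rfl⟩ ?_
    rintro _ ⟨C', hC', rfl⟩
    obtain ⟨r', hr', hle, hs⟩ := hC'.exists_candidate
    exact (hleast ⟨hr', card_greedyLeft_le hs (hpick r')⟩).trans hle
  simp only [greedyBalls]
  linarith

theorem opt_zero {a : X} (ha : a ∈ A) (k z : ℕ) : opt A k z 0 = 0 :=
  le_antisymm (IsSolution.opt_le (C := ⟨fun _ : Fin k => a, 0⟩) ⟨le_rfl, fun _ => ha, by simp⟩)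
    (opt_nonneg _ _ _ _)

theorem opt_le_of_dist_le {D : ℝ} (hk : 1 ≤ k) (hD : 0 ≤ D) {a : X} (ha : a ∈ A)
    (hQ : ∀ x ∈ Q, dist x a ≤ D) : opt A k z Q ≤ D := by
  refine IsSolution.opt_le (C := ⟨fun _ : Fin k => a, D⟩) ⟨hD, fun _ => ha, ?_⟩
  rw [Multiset.countP_eq_zero.2]
  · exact Nat.zero_le _
  · intro x hx hn
    exact hn ⟨⟨0, hk⟩, by simpa using hQ x hx⟩

/-! ### Packing in doubling spaces. -/

/-- In a space of doubling dimension at most `d`, a ball is covered by `2 ^ (d * m)` balls whose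
radius is smaller by a factor `2 ^ m`. -/
theorem DoublingDimLE.exists_cover {d : ℝ} (h : DoublingDimLE X d) (m : ℕ) (x : X) {r : ℝ}
    (hr : 0 < r) : ∃ F : Finset X, (F.card : ℝ) ≤ ((2 : ℝ) ^ d) ^ m ∧
      Metric.closedBall x r ⊆ ⋃ y ∈ F, Metric.closedBall y (r / 2 ^ m) := by
  induction m with
  | zero => exact ⟨{x}, by simp, by simp⟩
  | succ m ih =>
    obtain ⟨F, hF, hcov⟩ := ih
    choose G hG hGcov using fun y => h y (r / 2 ^ m) (by positivity)
    refine ⟨F.biUnion G, ?_, fun w hw => ?_⟩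
    · calc ((F.biUnion G).card : ℝ) ≤ ∑ y ∈ F, ((G y).card : ℝ) := by
            exact_mod_cast Finset.card_biUnion_le
        _ ≤ ∑ y ∈ F, (2 : ℝ) ^ d := Finset.sum_le_sum fun y _ => hG y
        _ = F.card * (2 : ℝ) ^ d := by rw [Finset.sum_const, nsmul_eq_mul]
        _ ≤ ((2 : ℝ) ^ d) ^ m * (2 : ℝ) ^ d := by gcongr
        _ = _ := (pow_succ _ _).symm
    · have := hcov hw
      simp only [Set.mem_iUnion] at this ⊢
      obtain ⟨y, hy, hwy⟩ := this
      have := hGcov y hwy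
      simp only [Set.mem_iUnion] at this
      obtain ⟨v, hv, hwv⟩ := this
      refine ⟨v, Finset.mem_biUnion.2 ⟨y, hy, hv⟩, ?_⟩
      rwa [div_div, ← pow_succ] at hwv

/-- A separated family inside the union of `k` balls is small. -/
theorem DoublingDimLE.card_le_of_separated {d : ℝ} (h : DoublingDimLE X d) {ι : Type*} (m : ℕ)
    {R s : ℝ} (hR : 0 < R) (hs : 2 * (R / 2 ^ m) ≤ s) (c : Fin k → X) (f : ι → X)
    (T : Finset ι) (hT : ∀ i ∈ T, ∃ j, dist (f i) (c j) ≤ R)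
    (hsep : ∀ i ∈ T, ∀ i' ∈ T, i ≠ i' → s < dist (f i) (f i')) :
    (T.card : ℝ) ≤ k * ((2 : ℝ) ^ d) ^ m := by
  choose F hF hcov using fun j => h.exists_cover m (c j) hR
  have hsub : T ⊆ (Finset.univ.sigma F).biUnion
      (fun p => T.filter (fun i => dist (f i) p.2 ≤ R / 2 ^ m)) := by
    intro i hi
    obtain ⟨j, hj⟩ := hT i hi
    have := hcov j (Metric.mem_closedBall.2 hj)
    simp only [Set.mem_iUnion] at this
    obtain ⟨y, hy, hiy⟩ := this
    exact Finset.mem_biUnion.2 ⟨⟨j, y⟩, Finset.mem_sigma.2 ⟨Finset.mem_univ _, hy⟩,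
      Finset.mem_filter.2 ⟨hi, hiy⟩⟩
  -- Two members of `T` in one small ball would be at distance at most `2 * (R / 2 ^ m) ≤ s`.
  have hone : ∀ p ∈ Finset.univ.sigma F,
      (T.filter (fun i => dist (f i) p.2 ≤ R / 2 ^ m)).card ≤ 1 := by
    intro p _
    rw [Finset.card_le_one]
    intro i hi i' hi'
    rw [Finset.mem_filter] at hi hi'
    by_contra hne
    have h1 := hsep i hi.1 i' hi'.1 hne
    have h2 := dist_triangle_right (f i) (f i') p.2
    linarith [hi.2, hi'.2]
  have hcard : T.card ≤ ∑ j, (F j).card := by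
    have := (Finset.card_le_card hsub).trans (Finset.card_biUnion_le_card_mul _ _ 1 hone)
    rwa [mul_one, Finset.card_sigma] at this
  calc (T.card : ℝ) ≤ ∑ j, ((F j).card : ℝ) := by exact_mod_cast hcard
    _ ≤ ∑ _j : Fin k, ((2 : ℝ) ^ d) ^ m := Finset.sum_le_sum fun j _ => hF j
    _ = _ := by simp

/-- Covering a nonempty ball takes at least one ball, so `1 ≤ 2 ^ d`. The sign makes `x ^ d`
monotone in the estimates. -/
theorem DoublingDimLE.nonneg [Nonempty X] {d : ℝ} (h : DoublingDimLE X d) : 0 ≤ d := by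
  obtain ⟨x⟩ := ‹Nonempty X›
  obtain ⟨F, hF, hcov⟩ := h x 1 one_pos
  have hx := hcov (Metric.mem_closedBall_self zero_le_one)
  simp only [Set.mem_iUnion] at hx
  obtain ⟨y, hy, -⟩ := hx
  have h1 : (1 : ℝ) ≤ F.card := by exact_mod_cast Finset.card_pos.2 ⟨y, hy⟩
  by_contra! hd
  have := Real.rpow_lt_one_of_one_lt_of_neg one_lt_two hd
  linarith

end Static

section

/-! ### The newest elements of a finite set. -/

section Newest

variable {m p : ℕ} {Q R : Finset ℕ}

theorem newest_subset (m : ℕ) (Q : Finset ℕ) : newest m Q ⊆ Q := Finset.filter_subset _ _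

theorem newest_zero (Q : Finset ℕ) : newest 0 Q = ∅ := by simp [newest]

/-- The other selected elements are all newer than the oldest selected one, which has fewer than `m`
newer elements. -/
theorem card_newest_le (m : ℕ) (Q : Finset ℕ) : (newest m Q).card ≤ m := by
  by_contra! hcon
  have hne : (newest m Q).Nonempty := Finset.card_pos.1 (by omega)
  have hmem := (newest m Q).min'_mem hne
  set a := (newest m Q).min' hne with ha
  have hsub : (newest m Q).erase a ⊆ Q.filter (fun b => a < b) := by
    intro b hb
    rw [Finset.mem_erase] at hb
    exact Finset.mem_filter.2 ⟨newest_subset _ _ hb.2,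
      lt_of_le_of_ne ((newest m Q).min'_le b hb.2) hb.1.symm⟩
  have h1 := Finset.card_le_card hsub
  rw [Finset.card_erase_of_mem hmem] at h1
  have h2 := (Finset.mem_filter.1 hmem).2
  omega

theorem le_card_newest (h : m ≤ Q.card) : m ≤ (newest m Q).card := by
  by_contra! hcon
  have hne : (Q \ newest m Q).Nonempty := by
    rw [Finset.sdiff_nonempty]
    intro hsub
    have := Finset.card_le_card hsub
    omega
  have hmem := Finset.mem_sdiff.1 ((Q \ newest m Q).max'_mem hne)
  set a := (Q \ newest m Q).max' hne with ha
  refine hmem.2 (Finset.mem_filter.2 ⟨hmem.1, lt_of_le_of_lt (Finset.card_le_card ?_) hcon⟩)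
  intro b hb
  rw [Finset.mem_filter] at hb
  by_contra hbn
  exact absurd ((Q \ newest m Q).le_max' b (Finset.mem_sdiff.2 ⟨hb.1, hbn⟩)) (not_le.2 hb.2)

theorem newest_card_self (Q : Finset ℕ) : newest Q.card Q = Q :=
  Finset.eq_of_subset_of_card_le (newest_subset _ _) (le_card_newest le_rfl)

/-- The elements of `R` crowd out everything not newer than `p`. Thus saturation survives truncation
to `z + 1` representatives. -/
theorem lt_of_mem_newest (hR : R ⊆ Q) (hm : m ≤ R.card) (hp : ∀ i ∈ R, p < i) {a : ℕ}
    (ha : a ∈ newest m Q) : p < a := by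
  by_contra! hcon
  have h1 : R ⊆ Q.filter (fun b => a < b) := fun b hb =>
    Finset.mem_filter.2 ⟨hR hb, lt_of_le_of_lt hcon (hp b hb)⟩
  have h2 := Finset.card_le_card h1
  have h3 := (Finset.mem_filter.1 ha).2
  omega

/-- An element missing from the `m` newest has at least `m` newer ones, so anything older ranks
beyond `m + 1`. This places the timestamp witness at or after the newest discarded element. -/
theorem le_of_mem_newest_succ (hp : p ∈ Q) (hpn : p ∉ newest m Q) {a : ℕ}
    (ha : a ∈ newest (m + 1) Q) : p ≤ a := by
  have hle : m ≤ (Q.filter (fun b => p < b)).card := by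
    by_contra! hcon
    exact hpn (Finset.mem_filter.2 ⟨hp, hcon⟩)
  by_contra! hcon
  have h1 : insert p (Q.filter (fun b => p < b)) ⊆ Q.filter (fun b => a < b) := by
    intro b hb
    rw [Finset.mem_insert, Finset.mem_filter] at hb
    rcases hb with rfl | hb
    · exact Finset.mem_filter.2 ⟨hp, hcon⟩
    · exact Finset.mem_filter.2 ⟨hb.1, hcon.trans hb.2⟩
  have h2 := Finset.card_le_card h1
  rw [Finset.card_insert_of_notMem (by simp)] at h2
  have h3 := (Finset.mem_filter.1 ha).2
  omega

end Newest

variable {X : Type u} {S : PointStream X}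

/-! ### Arrival and expiration order of the stream. -/

namespace PointStream

theorem points_mono (S : PointStream X) {Q Q' : Finset ℕ} (h : Q ⊆ Q') :
    S.points Q ≤ S.points Q' :=
  Multiset.map_le_map (Finset.val_le_iff.2 h)

theorem countP_points (S : PointStream X) (Q : Finset ℕ) (p : X → Prop)
    [DecidablePred p] :
    (S.points Q).countP p = (Q.filter (fun i => p (S.pt i))).card := by
  rw [points, Multiset.countP_map]
  rfl

theorem exp_mono (W : ℝ) {i j : ℕ} (h : i ≤ j) (hj : (j : ℕ∞) < S.len) :
    S.exp W i ≤ S.exp W j := by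
  rcases h.eq_or_lt with rfl | h
  · exact le_rfl
  · have := S.arr_lt i j h hj
    simp only [exp]; linarith

theorem mem_arrived {t : ℝ} {i : ℕ} : i ∈ S.arrived t ↔ (i : ℕ∞) < S.len ∧ S.arr i ≤ t := by
  simp [arrived]

theorem arrived_eq_range (S : PointStream X) (t : ℝ) :
    S.arrived t = Finset.range (S.arrived t).card := by
  have hlow : ∀ i ∈ S.arrived t, Finset.range (i + 1) ⊆ S.arrived t := by
    intro i hi j hj
    rw [mem_arrived] at hi ⊢
    rcases (Nat.lt_succ_iff.1 (Finset.mem_range.1 hj)).eq_or_lt with rfl | hlt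
    · exact hi
    · exact ⟨lt_trans (by exact_mod_cast hlt) hi.1, (S.arr_lt j i hlt hi.1).le.trans hi.2⟩
  refine Finset.eq_of_subset_of_card_le (fun i hi => ?_) (by simp)
  have := Finset.card_le_card (hlow i hi)
  rw [Finset.card_range] at this
  exact Finset.mem_range.2 this

theorem lt_card_arrived {t : ℝ} {i : ℕ} :
    i < (S.arrived t).card ↔ (i : ℕ∞) < S.len ∧ S.arr i ≤ t := by
  rw [← mem_arrived, arrived_eq_range, Finset.mem_range, Finset.card_range]

end PointStream

variable [MetricSpace X]

/-! ### Assigning elements to mini-balls. -/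

namespace MiniBalls

/-- All representatives lie in their mini-balls. -/
def RepsClose (S : PointStream X) (r : ℝ) (M : MiniBalls) : Prop :=
  ∀ b ∈ M.centers, ∀ i ∈ M.rep b, dist (S.pt i) (S.pt b) ≤ r

/-- No centre of a mini-ball lies in another mini-ball. -/
def Separated (S : PointStream X) (r : ℝ) (M : MiniBalls) : Prop :=
  ∀ b ∈ M.centers, ∀ b' ∈ M.centers, b ≠ b' → r < dist (S.pt b) (S.pt b')

theorem mem_reps {M : MiniBalls} {i : ℕ} : i ∈ M.reps ↔ ∃ b ∈ M.centers, i ∈ M.rep b :=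
  Finset.mem_biUnion

/-- `M'` arises from `M` by storing the elements of `F` as further representatives. -/
structure IsExtension (S : PointStream X) (r : ℝ) (M : MiniBalls) (F : Set ℕ)
    (M' : MiniBalls) : Prop where
  close : M'.RepsClose S r
  separated : M'.Separated S r
  centers_subset : M.centers ⊆ M'.centers
  rep_subset : ∀ b ∈ M.centers, M.rep b ⊆ M'.rep b
  stored : ∀ q ∈ F, ∃ b ∈ M'.centers, q ∈ M'.rep b
  centers_le : ∀ b ∈ M'.centers, b ∈ M.centers ∨ b ∈ F
  reps_le : ∀ b ∈ M'.centers, ∀ i ∈ M'.rep b, i ∈ M.reps ∨ i ∈ F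

theorem containing_subset (M : MiniBalls) (S : PointStream X) (r : ℝ) (q : ℕ) :
    M.containing S r q ⊆ M.centers := Finset.filter_subset _ _

theorem addRep_rep_subset {M : MiniBalls} {b q : ℕ} (c : ℕ) : M.rep c ⊆ (M.addRep b q).rep c := by
  intro i hi
  simp only [addRep, Function.update_apply]
  split_ifs with hc
  · subst hc; exact Finset.mem_insert_of_mem hi
  · exact hi

theorem mem_addRep_rep {M : MiniBalls} {b q c i : ℕ} (hi : i ∈ (M.addRep b q).rep c) :
    i ∈ M.rep c ∨ (i = q ∧ c = b) := by
  simp only [addRep, Function.update_apply] at hi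
  split_ifs at hi with hc
  · subst hc
    rcases Finset.mem_insert.1 hi with h | h
    · exact Or.inr ⟨h, rfl⟩
    · exact Or.inl h
  · exact Or.inl hi

theorem mem_addRep_self {M : MiniBalls} {b q : ℕ} : q ∈ (M.addRep b q).rep b := by
  simp [addRep]

theorem RepsClose.addRep {r : ℝ} {M : MiniBalls} (h : M.RepsClose S r) {b q : ℕ}
    (hb : b ∈ M.containing S r q) : (M.addRep b q).RepsClose S r := by
  intro c hc i hi
  rcases mem_addRep_rep hi with hi | ⟨rfl, rfl⟩
  · exact h c hc i hi
  · exact (Finset.mem_filter.1 hb).2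

theorem isExtension_assign {r : ℝ} (hr : 0 ≤ r) {M : MiniBalls} (hc : M.RepsClose S r)
    (hs : M.Separated S r) (tb : TieBreak) (j q : ℕ) :
    M.IsExtension S r {q} (M.assign S tb r j q) := by
  unfold assign
  split_ifs with h
  · have hb := tb.pick_mem j q _ h
    set b := tb.pick j q (M.containing S r q)
    have hbc : b ∈ M.centers := containing_subset _ _ _ _ hb
    refine ⟨hc.addRep hb, hs, subset_rfl, fun c _ => addRep_rep_subset c, ?_, fun c h => Or.inl h,
      fun c hcc i hi => ?_⟩
    · rintro _ rfl
      exact ⟨b, hbc, mem_addRep_self⟩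
    · rcases mem_addRep_rep hi with hi | ⟨rfl, rfl⟩
      · exact Or.inl (mem_reps.2 ⟨c, hcc, hi⟩)
      · exact Or.inr rfl
  · have hfar : ∀ b ∈ M.centers, r < dist (S.pt q) (S.pt b) := by
      intro b hb
      by_contra! hcon
      exact h ⟨b, Finset.mem_filter.2 ⟨hb, hcon⟩⟩
    -- A centre lies in its own mini-ball; hence `create` overwrites no existing representative set.
    have hq : q ∉ M.centers := by
      intro hq
      have := hfar q hq
      rw [dist_self] at this
      linarith
    have hrep : ∀ b ∈ M.centers, (M.create q).rep b = M.rep b := by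
      intro b hb
      have : b ≠ q := by rintro rfl; exact hq hb
      simp [create, this]
    have hrepq : (M.create q).rep q = {q} := by simp [create]
    have hcent : ∀ b, b ∈ (M.create q).centers ↔ b = q ∨ b ∈ M.centers := by
      intro b; simp [create]
    refine ⟨?_, ?_, fun b hb => (hcent b).2 (Or.inr hb), fun b hb => (hrep b hb).ge, ?_, ?_, ?_⟩
    · intro b hb i hi
      rcases (hcent b).1 hb with rfl | hb
      · rw [hrepq, Finset.mem_singleton] at hi
        simp [hi, hr]
      · rw [hrep b hb] at hi
        exact hc b hb i hi
    · intro b hb b' hb' hne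
      rcases (hcent b).1 hb with hbq | hbM <;> rcases (hcent b').1 hb' with hbq' | hbM'
      · exact absurd (hbq.trans hbq'.symm) hne
      · rw [hbq]; exact hfar b' hbM'
      · rw [hbq', dist_comm]; exact hfar b hbM
      · exact hs b hbM b' hbM' hne
    · intro p hp
      rw [Set.mem_singleton_iff] at hp
      exact ⟨q, (hcent q).2 (Or.inl rfl), by simp [hrepq, hp]⟩
    · intro b hb
      rcases (hcent b).1 hb with rfl | hb
      · exact Or.inr rfl
      · exact Or.inl hb
    · intro b hb i hi
      rcases (hcent b).1 hb with rfl | hb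
      · rw [hrepq, Finset.mem_singleton] at hi
        exact Or.inr hi
      · rw [hrep b hb] at hi
        exact Or.inl (mem_reps.2 ⟨b, hb, hi⟩)

/-- Only membership in `l` enters the conclusion, so the order of traversal is immaterial. -/
theorem isExtension_foldl {r : ℝ} (hr : 0 ≤ r) (tb : TieBreak) (j : ℕ) (l : List ℕ)
    {M : MiniBalls} (hc : M.RepsClose S r) (hs : M.Separated S r) :
    M.IsExtension S r {q | q ∈ l} (l.foldl (MiniBalls.assign S tb r j) M) := by
  induction l generalizing M with
  | nil => exact ⟨hc, hs, subset_rfl, fun _ _ => subset_rfl, by simp, fun b h => Or.inl h,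
      fun b hb i hi => Or.inl (mem_reps.2 ⟨b, hb, hi⟩)⟩
  | cons q l ih =>
    have h₁ := isExtension_assign hr hc hs tb j q
    have h₂ := ih h₁.close h₁.separated
    rw [List.foldl_cons]
    refine ⟨h₂.close, h₂.separated, h₁.centers_subset.trans h₂.centers_subset, fun b hb =>
      (h₁.rep_subset b hb).trans (h₂.rep_subset b (h₁.centers_subset hb)), ?_, ?_, ?_⟩
    · intro p hp
      rcases List.mem_cons.1 hp with rfl | hp
      · obtain ⟨b, hb, hpb⟩ := h₁.stored p rfl
        exact ⟨b, h₂.centers_subset hb, h₂.rep_subset b hb hpb⟩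
      · exact h₂.stored p hp
    · intro b hb
      rcases h₂.centers_le b hb with hb | hb
      · rcases h₁.centers_le b hb with hb | rfl
        · exact Or.inl hb
        · exact Or.inr List.mem_cons_self
      · exact Or.inr (List.mem_cons_of_mem _ hb)
    · intro b hb i hi
      rcases h₂.reps_le b hb i hi with hi | hi
      · obtain ⟨c, hcc, hi⟩ := mem_reps.1 hi
        rcases h₁.reps_le c hcc i hi with hi | rfl
        · exact Or.inl hi
        · exact Or.inr List.mem_cons_self
      · exact Or.inr (List.mem_cons_of_mem _ hi)

end MiniBalls

end

/-! ### Rebuilding the sketch and the invariant. -/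

section

variable {X : Type u} [MetricSpace X] {k : ℕ} {S : PointStream X}

/-- Element `p` lies in a mini-ball that has more than `z` representatives, all of which are newer
than `p`. -/
def MiniBalls.Saturated (S : PointStream X) (r : ℝ) (z p : ℕ) (M : MiniBalls) : Prop :=
  ∃ b ∈ M.centers, dist (S.pt p) (S.pt b) ≤ r ∧ z + 1 ≤ (M.rep b).card ∧ ∀ i ∈ M.rep b, p < i

theorem Sketch.mem_elems {Γ : Sketch} {i : ℕ} :
    i ∈ Γ.elems ↔ (∃ b ∈ Γ.centers, i ∈ Γ.rep b) ∨ i ∈ Γ.out := by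
  rw [Sketch.elems, Finset.mem_union, MiniBalls.mem_reps]

/-- Properties of a sketch that result from a rebuild of the mini-balls `M` with the elements of
`kept` and the balls `B`. -/
structure Sketch.IsRebuilt (S : PointStream X) (r : ℝ) (z : ℕ) (M : MiniBalls) (kept : Finset ℕ)
    (B : Balls X k) (Γ : Sketch) : Prop where
  close : Γ.toMiniBalls.RepsClose S r
  separated : Γ.toMiniBalls.Separated S r
  elems_subset : Γ.elems ⊆ kept
  covers : ∀ b ∈ Γ.centers, B.CoversWithin r (S.pt b)
  card_rep : ∀ b ∈ Γ.centers, (Γ.rep b).card ≤ z + 1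
  card_out : Γ.out.card ≤ z
  stored : ∀ q ∈ kept, q ∈ Γ.elems ∨ Γ.toMiniBalls.Saturated S r z q
  saturated : ∀ p, M.Saturated S r z p → (∀ w ∈ M.reps, p < w → w ∈ kept) →
    Γ.toMiniBalls.Saturated S r z p

theorem isRebuilt_rebuild (tb : TieBreak) (z : ℕ) {ρ ε : ℝ} (hr : 0 ≤ ε * ρ) (τ : ℝ) (j : ℕ)
    {M : MiniBalls} (hc : M.RepsClose S (ε * ρ)) (hs : M.Separated S (ε * ρ)) (kept : Finset ℕ)
    {B : Balls X k}
    (hB : (kept.filter (fun i => ¬ B.CoversWithin 0 (S.pt i))).card ≤ z) :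
    (rebuild S tb z ρ ε τ j M kept B).IsRebuilt S (ε * ρ) z M kept B := by
  set M₀ : MiniBalls :=
    { centers := M.centers.filter (fun b => B.CoversWithin (ε * ρ) (S.pt b))
      rep := fun b => M.rep b ∩ kept } with hM₀
  set Z : Finset ℕ := kept \ M₀.reps with hZ
  set Zin : Finset ℕ := Z.filter (fun q => B.CoversWithin (ε * ρ) (S.pt q)) with hZin
  set M₁ : MiniBalls := (tb.order j Zin).foldl (MiniBalls.assign S tb (ε * ρ) j) M₀ with hM₁
  have hdef : rebuild S tb z ρ ε τ j M kept B =
    { centers := M₁.centers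
      rep := fun b => newest (z + 1) (M₁.rep b)
      τ := τ
      out := Z \ Zin } := rfl
  have hM₀c : ∀ b ∈ M₀.centers, b ∈ M.centers ∧ B.CoversWithin (ε * ρ) (S.pt b) :=
    fun b hb => Finset.mem_filter.1 hb
  have hc₀ : M₀.RepsClose S (ε * ρ) := fun b hb i hi =>
    hc b (hM₀c b hb).1 i (Finset.mem_inter.1 hi).1
  have hs₀ : M₀.Separated S (ε * ρ) := fun b hb b' hb' hne =>
    hs b (hM₀c b hb).1 b' (hM₀c b' hb').1 hne
  have hext := MiniBalls.isExtension_foldl hr tb j (tb.order j Zin) hc₀ hs₀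
  rw [← hM₁] at hext
  have hord : ∀ q, q ∈ tb.order j Zin ↔ q ∈ Zin := fun q => by
    rw [← List.mem_toFinset, tb.order_toFinset]
  have hZin_kept : ∀ q ∈ Zin, q ∈ kept := fun q hq =>
    (Finset.mem_sdiff.1 (Finset.mem_filter.1 hq).1).1
  have hrep₀ : ∀ i ∈ M₀.reps, i ∈ kept := by
    intro i hi
    obtain ⟨b, -, hi⟩ := MiniBalls.mem_reps.1 hi
    exact (Finset.mem_inter.1 hi).2
  have hcov : ∀ x, B.CoversWithin 0 x → B.CoversWithin (ε * ρ) x := by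
    rintro x ⟨i, hi⟩
    exact ⟨i, by linarith⟩
  rw [hdef]
  refine ⟨fun b hb i hi => hext.close b hb i (newest_subset _ _ hi), hext.separated, ?_, ?_,
    fun b _ => card_newest_le _ _, ?_, ?_, ?_⟩
  · intro i hi
    rcases Sketch.mem_elems.1 hi with ⟨b, hb, hib⟩ | hi
    · rcases hext.reps_le b hb i (newest_subset _ _ hib) with h | h
      · exact hrep₀ i h
      · exact hZin_kept i ((hord i).1 h)
    · exact (Finset.mem_sdiff.1 (Finset.mem_sdiff.1 hi).1).1
  · intro b hb
    rcases hext.centers_le b hb with h | h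
    · exact (hM₀c b h).2
    · exact (Finset.mem_filter.1 ((hord b).1 h)).2
  -- Elements put into `out` miss even the expanded balls, so they are outliers of `B`.
  · refine le_trans (Finset.card_le_card fun i hi => ?_) hB
    rw [Finset.mem_sdiff] at hi
    refine Finset.mem_filter.2 ⟨(Finset.mem_sdiff.1 hi.1).1, fun hcv => hi.2 ?_⟩
    exact Finset.mem_filter.2 ⟨hi.1, hcov _ hcv⟩
  · intro q hq
    have hmem : q ∈ Z \ Zin ∨ ∃ b ∈ M₁.centers, q ∈ M₁.rep b := by
      by_cases hq₀ : q ∈ M₀.reps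
      · obtain ⟨b, hb, hqb⟩ := MiniBalls.mem_reps.1 hq₀
        exact Or.inr ⟨b, hext.centers_subset hb, hext.rep_subset b hb hqb⟩
      · have hqZ : q ∈ Z := Finset.mem_sdiff.2 ⟨hq, hq₀⟩
        by_cases hqin : q ∈ Zin
        · exact Or.inr (hext.stored q ((hord q).2 hqin))
        · exact Or.inl (Finset.mem_sdiff.2 ⟨hqZ, hqin⟩)
    rcases hmem with h | ⟨b, hb, hqb⟩
    · exact Or.inl (Sketch.mem_elems.2 (Or.inr h))
    · by_cases hn : q ∈ newest (z + 1) (M₁.rep b)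
      · exact Or.inl (Sketch.mem_elems.2 (Or.inl ⟨b, hb, hn⟩))
      -- An element cut by the truncation has at least `z + 1` newer representatives in its own
      -- mini-ball, so it becomes saturated.
      · have hle : z + 1 ≤ ((M₁.rep b).filter (fun i => q < i)).card := by
          by_contra! hcon
          exact hn (Finset.mem_filter.2 ⟨hqb, hcon⟩)
        refine Or.inr ⟨b, hb, hext.close b hb q hqb,
          le_card_newest (hle.trans (Finset.card_filter_le _ _)), fun i hi => ?_⟩
        exact lt_of_mem_newest (Finset.filter_subset _ _) hle
          (fun i hi => (Finset.mem_filter.1 hi).2) hi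
  · rintro p ⟨b, hb, hpb, hcard, hlt⟩ hkept
    have hsub : M.rep b ⊆ kept := fun w hw =>
      hkept w (MiniBalls.mem_reps.2 ⟨b, hb, hw⟩) (hlt w hw)
    -- At most `z` kept elements are outliers of `B`, so one of the `z + 1` representatives is
    -- covered. The centre is within a mini-ball radius of it, hence in an expanded ball.
    have hw : ∃ w ∈ M.rep b, B.CoversWithin 0 (S.pt w) := by
      by_contra! hcon
      have := Finset.card_le_card (show M.rep b ⊆
        kept.filter (fun i => ¬ B.CoversWithin 0 (S.pt i)) from
        fun w hw => Finset.mem_filter.2 ⟨hsub hw, hcon w hw⟩)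
      omega
    obtain ⟨w, hw, i, hi⟩ := hw
    have hb₀ : b ∈ M₀.centers := by
      refine Finset.mem_filter.2 ⟨hb, i, ?_⟩
      have h1 := dist_triangle (S.pt b) (S.pt w) (B.center i)
      have h2 := hc b hb w hw
      rw [dist_comm] at h2
      linarith
    have hsub₁ : M.rep b ⊆ M₁.rep b := fun w hw =>
      hext.rep_subset b hb₀ (Finset.mem_inter.2 ⟨hw, hsub hw⟩)
    exact ⟨b, hext.centers_subset hb₀, hpb,
      le_card_newest (hcard.trans (Finset.card_le_card hsub₁)),
      fun i hi => lt_of_mem_newest hsub₁ hcard hlt hi⟩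

section InsertNew

variable {Γ : Sketch} {r : ℝ} (tb : TieBreak) (j : ℕ)

theorem insertNew_close (hc : Γ.toMiniBalls.RepsClose S r) :
    (Γ.insertNew S tb r j).toMiniBalls.RepsClose S r := by
  unfold Sketch.insertNew
  split_ifs with h
  · exact hc.addRep (tb.pick_mem j j _ h)
  · exact hc

theorem insertNew_centers : (Γ.insertNew S tb r j).centers = Γ.centers := by
  unfold Sketch.insertNew
  split_ifs <;> rfl

theorem mem_insertNew_elems {i : ℕ} :
    i ∈ (Γ.insertNew S tb r j).elems ↔ i = j ∨ i ∈ Γ.elems := by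
  unfold Sketch.insertNew
  split_ifs with h
  · have hb := MiniBalls.containing_subset _ _ _ _ (tb.pick_mem j j _ h)
    rw [Sketch.mem_elems, Sketch.mem_elems]
    constructor
    · rintro (⟨c, hc, hi⟩ | hi)
      · rcases MiniBalls.mem_addRep_rep hi with hi | ⟨rfl, -⟩
        · exact Or.inr (Or.inl ⟨c, hc, hi⟩)
        · exact Or.inl rfl
      · exact Or.inr (Or.inr hi)
    · rintro (rfl | ⟨c, hc, hi⟩ | hi)
      · exact Or.inl ⟨_, hb, MiniBalls.mem_addRep_self⟩
      · exact Or.inl ⟨c, hc, MiniBalls.addRep_rep_subset c hi⟩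
      · exact Or.inr hi
  · rw [Sketch.mem_elems, Sketch.mem_elems]
    simp only [Finset.mem_insert]
    exact or_left_comm

theorem insertNew_saturated {z p : ℕ} (hp : p < j) (h : Γ.toMiniBalls.Saturated S r z p) :
    (Γ.insertNew S tb r j).toMiniBalls.Saturated S r z p := by
  unfold Sketch.insertNew
  split_ifs with hne
  · obtain ⟨b, hb, hpb, hcard, hlt⟩ := h
    refine ⟨b, hb, hpb, hcard.trans (Finset.card_le_card (MiniBalls.addRep_rep_subset b)),
      fun i hi => ?_⟩
    rcases MiniBalls.mem_addRep_rep hi with hi | ⟨rfl, -⟩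
    · exact hlt i hi
    · exact hp
  · exact h

end InsertNew

/-- The invariant of the decision sketch with parameters `ρ` and `r / ρ` at time `t`, after the
arrival of the elements less than `n`. -/
structure Sketch.Valid (S : PointStream X) (W : ℝ) (A : Set X) (k z : ℕ) (ρ r N : ℝ) (n : ℕ)
    (t : ℝ) (Γ : Sketch) : Prop where
  close : Γ.toMiniBalls.RepsClose S r
  separated : Γ.toMiniBalls.Separated S r
  alive : ∀ i ∈ Γ.elems, i < n ∧ t < S.exp W i
  stored : ∀ p < n, Γ.τ < S.exp W p → t < S.exp W p →
    p ∈ Γ.elems ∨ Γ.toMiniBalls.Saturated S r z p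
  timestamp : Γ.τ = 0 ∨ ∃ T : Finset ℕ, (∀ i ∈ T, i < n ∧ Γ.τ ≤ S.exp W i) ∧
    2 * ρ < opt A k z (S.points T)
  card_centers : (Γ.centers.card : ℝ) ≤ N
  card_rep : ∀ b ∈ Γ.centers, (Γ.rep b).card ≤ z + 1
  card_out : Γ.out.card ≤ z

/-! ### The invariant is preserved by departures and arrivals. -/

section Valid

variable {W : ℝ} {A : Set X} {z : ℕ} {ρ r N : ℝ} {n : ℕ} {t : ℝ} {Γ : Sketch}

theorem valid_init (hN : 0 ≤ N) : Sketch.init.Valid S W A k z ρ r N 0 t where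
  close := fun b hb => absurd hb (Finset.notMem_empty b)
  separated := fun b hb => absurd hb (Finset.notMem_empty b)
  alive := fun i hi => by simp [Sketch.mem_elems, Sketch.init] at hi
  stored := fun p hp => absurd hp (Nat.not_lt_zero p)
  timestamp := Or.inl rfl
  card_centers := by simpa [Sketch.init] using hN
  card_rep := fun b hb => absurd hb (Finset.notMem_empty b)
  card_out := Nat.zero_le _

theorem Sketch.Valid.expire {t' : ℝ} (h : Γ.Valid S W A k z ρ r N n t) (ht : t ≤ t')
    (hn : ∀ i < n, (i : ℕ∞) < S.len) : (Γ.expire S W t').Valid S W A k z ρ r N n t' := by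
  have hcent : (Γ.expire S W t').centers ⊆ Γ.centers := Finset.filter_subset _ _
  have hrep : ∀ b i, i ∈ (Γ.expire S W t').rep b ↔ i ∈ Γ.rep b ∧ t' < S.exp W i :=
    fun b i => Finset.mem_filter
  refine ⟨fun b hb i hi => h.close b (hcent hb) i ((hrep b i).1 hi).1,
    fun b hb b' hb' => h.separated b (hcent hb) b' (hcent hb'), ?_, ?_, h.timestamp,
    le_trans (by exact_mod_cast Finset.card_le_card hcent) h.card_centers,
    fun b hb => (Finset.card_filter_le _ _).trans (h.card_rep b (hcent hb)),
    (Finset.card_filter_le _ _).trans h.card_out⟩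
  · intro i hi
    rcases Sketch.mem_elems.1 hi with ⟨b, hb, hib⟩ | hi
    · have := (hrep b i).1 hib
      exact ⟨(h.alive i (Sketch.mem_elems.2 (Or.inl ⟨b, hcent hb, this.1⟩))).1, this.2⟩
    · have := Finset.mem_filter.1 hi
      exact ⟨(h.alive i (Sketch.mem_elems.2 (Or.inr this.1))).1, this.2⟩
  · intro p hp hτ hpt
    have hmemc : ∀ b ∈ Γ.centers, ∀ i ∈ Γ.rep b, t' < S.exp W i →
        b ∈ (Γ.expire S W t').centers := fun b hb i hi hit =>
      Finset.mem_filter.2 ⟨hb, Or.inr ⟨i, Finset.mem_filter.2 ⟨hi, hit⟩⟩⟩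
    rcases h.stored p hp hτ (ht.trans_lt hpt) with hmem | ⟨b, hb, hpb, hcard, hlt⟩
    · refine Or.inl (Sketch.mem_elems.2 ?_)
      rcases Sketch.mem_elems.1 hmem with ⟨b, hb, hi⟩ | hi
      · exact Or.inl ⟨b, hmemc b hb p hi hpt, (hrep b p).2 ⟨hi, hpt⟩⟩
      · exact Or.inr (Finset.mem_filter.2 ⟨hi, hpt⟩)
    -- Representatives newer than a live `p` are themselves alive, so this mini-ball loses nothing.
    · have hall : ∀ i ∈ Γ.rep b, t' < S.exp W i := fun i hi =>
        hpt.trans_le (S.exp_mono W (hlt i hi).le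
          (hn i (h.alive i (Sketch.mem_elems.2 (Or.inl ⟨b, hb, hi⟩))).1))
      have heq : (Γ.expire S W t').rep b = Γ.rep b := Finset.filter_true_of_mem hall
      obtain ⟨i, hi⟩ : (Γ.rep b).Nonempty := Finset.card_pos.1 (by omega)
      exact Or.inr ⟨b, hmemc b hb i hi (hall i hi), hpb, by rw [heq]; exact hcard,
        by rw [heq]; exact hlt⟩

theorem radius_approx_keepCount {approx : Multiset X → Balls X k}
    (happrox : ∀ Q, IsApprox A z 3 Q (approx Q)) (hk : 1 ≤ k) (hρ : 0 ≤ ρ) (Q : Finset ℕ) :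
    (approx (S.points (newest (keepCount S approx ρ Q) Q))).radius ≤ 6 * ρ := by
  -- `Nat.findGreatest` defaults to 0, so index 0 has to qualify: the empty multiset has optimum 0.
  refine Nat.findGreatest_spec (P := fun i => (approx (S.points (newest i Q))).radius ≤ 6 * ρ)
    (Nat.zero_le _) ?_
  have h := happrox (S.points (newest 0 Q))
  have h0 : S.points (newest 0 Q) = 0 := by rw [newest_zero]; rfl
  rw [h0] at h ⊢
  have := h.2
  rw [opt_zero (h.1.2.1 ⟨0, hk⟩)] at this
  linarith

/-- The elements from the newest one that is not kept onwards have no solution of radius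
`2 * ρ`. -/
theorem lt_opt_of_notMem_kept {approx : Multiset X → Balls X k}
    (happrox : ∀ Q, IsApprox A z 3 Q (approx Q)) {Q : Finset ℕ} {q : ℕ}
    (hq : q ∈ Q \ newest (keepCount S approx ρ Q) Q) :
    ∃ T ⊆ Q, (∀ i ∈ T, q ≤ i) ∧ 2 * ρ < opt A k z (S.points T) := by
  rw [Finset.mem_sdiff] at hq
  set c := keepCount S approx ρ Q with hc
  -- One element beyond the largest good index, `approx` exceeds `6 * ρ`; the factor 3 then puts the
  -- optimum above `2 * ρ`.
  refine ⟨newest (c + 1) Q, newest_subset _ _, fun i hi => le_of_mem_newest_succ hq.1 hq.2 hi, ?_⟩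
  have hle : c ≤ Q.card := Nat.findGreatest_le _
  have hne : c ≠ Q.card := by
    intro h
    rw [h, newest_card_self] at hq
    exact hq.2 hq.1
  have hnot : ¬ (approx (S.points (newest (c + 1) Q))).radius ≤ 6 * ρ :=
    Nat.findGreatest_is_greatest (P := fun i => (approx (S.points (newest i Q))).radius ≤ 6 * ρ)
      (Nat.lt_succ_self c) (by omega)
  have := (happrox (S.points (newest (c + 1) Q))).2
  linarith

/-- The hypothesis `hN` isolates the packing bound, so that the invariant is independent of the
doubling dimension. -/
theorem Sketch.Valid.arrive {ε : ℝ} {approx : Multiset X → Balls X k}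
    (happrox : ∀ Q, IsApprox A z 3 Q (approx Q)) (hk : 1 ≤ k) (hρ : 0 ≤ ρ) (hε : 0 ≤ ε)
    (tb : TieBreak)
    (hN : ∀ (c : Fin k → X) (F : Finset ℕ), (∀ i ∈ F, ∃ j, dist (S.pt i) (c j) ≤ (6 + ε) * ρ) →
      (∀ i ∈ F, ∀ i' ∈ F, i ≠ i' → ε * ρ < dist (S.pt i) (S.pt i')) → (F.card : ℝ) ≤ N)
    (hW : 0 < W) (hn : (n : ℕ∞) < S.len)
    (h : Γ.Valid S W A k z ρ (ε * ρ) N n (S.arr n)) :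
    (Γ.arrive S W z approx tb ρ ε n).Valid S W A k z ρ (ε * ρ) N (n + 1) (S.arr n) := by
  have hlen : ∀ i < n + 1, (i : ℕ∞) < S.len := fun i hi =>
    lt_of_le_of_lt (by exact_mod_cast Nat.lt_succ_iff.1 hi) hn
  set Γ₁ := Γ.insertNew S tb (ε * ρ) n with hΓ₁
  set Q := Γ₁.elems with hQ
  set kept := newest (keepCount S approx ρ Q) Q with hkept
  set B := approx (S.points kept) with hBdef
  set τ := newTimestamp S W Γ.τ Q kept with hτ
  have hdef : Γ.arrive S W z approx tb ρ ε n = rebuild S tb z ρ ε τ n Γ₁.toMiniBalls kept B := rfl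
  have hr : 0 ≤ ε * ρ := mul_nonneg hε hρ
  have hBsol : IsSolution A z (S.points kept) B := (happrox _).1
  have hBcard := hBsol.2.2
  rw [S.countP_points] at hBcard
  have hBr : B.radius ≤ 6 * ρ := radius_approx_keepCount happrox hk hρ Q
  have hs₁ : Γ₁.toMiniBalls.Separated S (ε * ρ) := by
    intro b hb b' hb'
    rw [hΓ₁, insertNew_centers] at hb hb'
    exact h.separated b hb b' hb'
  have hreb := isRebuilt_rebuild (S := S) tb z hr τ n (insertNew_close tb n h.close) hs₁ kept
    (B := B) hBcard
  rw [← hΓ₁, ← hdef] at hreb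
  have hτdef : (Γ.arrive S W z approx tb ρ ε n).τ = τ := rfl
  have hQalive : ∀ i ∈ Q, i < n + 1 ∧ S.arr n < S.exp W i := by
    intro i hi
    rcases (mem_insertNew_elems tb n).1 hi with rfl | hi
    · exact ⟨Nat.lt_succ_self i, by simp only [PointStream.exp]; linarith⟩
    · have := h.alive i hi
      exact ⟨this.1.trans (Nat.lt_succ_self n), this.2⟩
  have hτle : Γ.τ ≤ τ := by
    rw [hτ, newTimestamp]
    split_ifs
    · exact le_max_left _ _
    · exact le_rfl
  -- Discarded elements expire no later than the newest discarded one, hence no later than the new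
  -- timestamp.
  have hτkept : ∀ w ∈ Q, τ < S.exp W w → w ∈ kept := by
    intro w hw hlt
    by_contra hcon
    have hwd : w ∈ Q \ kept := Finset.mem_sdiff.2 ⟨hw, hcon⟩
    have hne : (Q \ kept).Nonempty := ⟨w, hwd⟩
    have hmax := (Q \ kept).max'_mem hne
    have h1 : S.exp W w ≤ S.exp W ((Q \ kept).max' hne) :=
      S.exp_mono W (Finset.le_max' _ w hwd) (hlen _ (hQalive _ (Finset.mem_sdiff.1 hmax).1).1)
    have h2 : S.exp W ((Q \ kept).max' hne) ≤ τ := by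
      rw [hτ, newTimestamp, dif_pos hne]
      exact le_max_right _ _
    linarith
  refine ⟨hreb.close, hreb.separated,
    fun i hi => hQalive i (newest_subset _ _ (hreb.elems_subset hi)), ?_, ?_, ?_, hreb.card_rep,
    hreb.card_out⟩
  · intro p hp hτp hpt
    rw [hτdef] at hτp
    by_cases hpQ : p ∈ Q
    · exact hreb.stored p (hτkept p hpQ hτp)
    · have hpn : p ≠ n := by
        rintro rfl
        exact hpQ ((mem_insertNew_elems tb p).2 (Or.inl rfl))
      have hpn' : p < n := by omega
      -- An element absent from `Q` was saturated before. Its representatives are newer, so they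
      -- outlive `τ` with it and are kept.
      rcases h.stored p hpn' (hτle.trans_lt hτp) hpt with hmem | hsat
      · exact absurd ((mem_insertNew_elems tb n).2 (Or.inr hmem)) hpQ
      · refine Or.inr (hreb.saturated p (insertNew_saturated tb n hpn' hsat) fun w hw hpw => ?_)
        have hwQ : w ∈ Q := Finset.mem_union_left _ hw
        exact hτkept w hwQ (hτp.trans_le (S.exp_mono W hpw.le (hlen w (hQalive w hwQ).1)))
  · rw [hτdef]
    have hold : Γ.τ = 0 ∨ ∃ T : Finset ℕ, (∀ i ∈ T, i < n + 1 ∧ Γ.τ ≤ S.exp W i) ∧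
        2 * ρ < opt A k z (S.points T) := by
      refine h.timestamp.imp_right ?_
      rintro ⟨T, hT, hopt⟩
      exact ⟨T, fun i hi => ⟨(hT i hi).1.trans (Nat.lt_succ_self n), (hT i hi).2⟩, hopt⟩
    by_cases hne : (Q \ kept).Nonempty
    · have hτ' : τ = max Γ.τ (S.exp W ((Q \ kept).max' hne)) := by
        rw [hτ, newTimestamp, dif_pos hne]
      -- Whichever term attains the maximum supplies the witness: the old one, or the one built from
      -- the newest discarded element.
      rcases max_choice Γ.τ (S.exp W ((Q \ kept).max' hne)) with hm | hm
      · rw [hτ', hm]; exact hold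
      · obtain ⟨T, hTQ, hT, hopt⟩ :=
          lt_opt_of_notMem_kept (S := S) happrox ((Q \ kept).max'_mem hne)
        rw [hτ', hm]
        refine Or.inr ⟨T, fun i hi => ?_, hopt⟩
        have hi' := (hQalive i (hTQ hi)).1
        exact ⟨hi', S.exp_mono W (hT i hi) (hlen i hi')⟩
    · have hτ' : τ = Γ.τ := by rw [hτ, newTimestamp, dif_neg hne]
      rw [hτ']; exact hold
  · refine hN B.center _ (fun i hi => ?_) hreb.separated
    obtain ⟨j, hj⟩ := hreb.covers i hi
    exact ⟨j, by linarith⟩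

theorem valid_sketchAfter {ε : ℝ} {approx : Multiset X → Balls X k}
    (happrox : ∀ Q, IsApprox A z 3 Q (approx Q)) (hk : 1 ≤ k) (hρ : 0 ≤ ρ) (hε : 0 ≤ ε)
    (tb : TieBreak) (hN₀ : 0 ≤ N)
    (hN : ∀ (c : Fin k → X) (F : Finset ℕ), (∀ i ∈ F, ∃ j, dist (S.pt i) (c j) ≤ (6 + ε) * ρ) →
      (∀ i ∈ F, ∀ i' ∈ F, i ≠ i' → ε * ρ < dist (S.pt i) (S.pt i')) → (F.card : ℝ) ≤ N)
    (hW : 0 < W) (n : ℕ) (hn : ∀ i < n, (i : ℕ∞) < S.len ∧ S.arr i ≤ t) :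
    ∃ t' ≤ t, (sketchAfter S W z approx tb ρ ε n).Valid S W A k z ρ (ε * ρ) N n t' ∧
      ∀ j, n ≤ j → (j : ℕ∞) < S.len → t' ≤ S.arr j := by
  induction n with
  | zero =>
    -- The empty sketch is valid at any time; this one precedes `t` and all arrivals, even for
    -- negative `t`.
    exact ⟨min 0 t, min_le_right _ _, valid_init hN₀, fun j _ hj =>
      (min_le_left _ _).trans (S.arr_nonneg j hj)⟩
  | succ n ih =>
    obtain ⟨t', -, hv, ht'⟩ := ih fun i hi => hn i (hi.trans (Nat.lt_succ_self n))
    obtain ⟨hlen, harr⟩ := hn n (Nat.lt_succ_self n)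
    refine ⟨S.arr n, harr, ?_, fun j hj hjl => (S.arr_lt n j hj hjl).le⟩
    exact (hv.expire (ht' n le_rfl hlen) fun i hi => (hn i (hi.trans (Nat.lt_succ_self n))).1).arrive
      happrox hk hρ hε tb hN hW hlen

theorem valid_sketchAt {ε : ℝ} {approx : Multiset X → Balls X k}
    (happrox : ∀ Q, IsApprox A z 3 Q (approx Q)) (hk : 1 ≤ k) (hρ : 0 ≤ ρ) (hε : 0 ≤ ε)
    (tb : TieBreak) (hN₀ : 0 ≤ N)
    (hN : ∀ (c : Fin k → X) (F : Finset ℕ), (∀ i ∈ F, ∃ j, dist (S.pt i) (c j) ≤ (6 + ε) * ρ) →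
      (∀ i ∈ F, ∀ i' ∈ F, i ≠ i' → ε * ρ < dist (S.pt i) (S.pt i')) → (F.card : ℝ) ≤ N)
    (hW : 0 < W) (t : ℝ) :
    (sketchAt S W z approx tb ρ ε t).Valid S W A k z ρ (ε * ρ) N (S.arrived t).card t := by
  have hn : ∀ i < (S.arrived t).card, (i : ℕ∞) < S.len ∧ S.arr i ≤ t := fun i hi =>
    PointStream.lt_card_arrived.1 hi
  obtain ⟨t', htt, hv, -⟩ := valid_sketchAfter happrox hk hρ hε tb hN₀ hN hW _ hn
  exact hv.expire htt fun i hi => (hn i hi).1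

/-! ### Consequences of the invariant: storage and correctness of the decision. -/

theorem Sketch.Valid.storage_le (h : Γ.Valid S W A k z ρ r N n t) :
    (Γ.storage : ℝ) ≤ 1 + z + N * (z + 2) := by
  have h1 : ∑ b ∈ Γ.centers, (Γ.rep b).card ≤ Γ.centers.card * (z + 1) := by
    simpa using Finset.sum_le_card_nsmul _ _ _ h.card_rep
  have h2 : Γ.storage ≤ 1 + Γ.centers.card + Γ.centers.card * (z + 1) + z := by
    have := h.card_out
    unfold Sketch.storage
    omega
  calc (Γ.storage : ℝ) ≤ 1 + Γ.centers.card + Γ.centers.card * (z + 1) + z := by exact_mod_cast h2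
    _ = 1 + z + Γ.centers.card * (z + 2) := by ring
    _ ≤ _ := by gcongr; exact h.card_centers

theorem Sketch.Valid.elems_subset_window (h : Γ.Valid S W A k z ρ r N (S.arrived t).card t) :
    Γ.elems ⊆ S.window W t := by
  intro i hi
  have := h.alive i hi
  exact Finset.mem_filter.2
    ⟨PointStream.mem_arrived.2 (PointStream.lt_card_arrived.1 this.1), this.2⟩

theorem Sketch.Valid.lt_opt_of_lt_timestamp
    (h : Γ.Valid S W A k z ρ r N (S.arrived t).card t) (ht : 0 ≤ t) {C : Balls X k}
    (hC : IsSolution A z (S.points (S.window W t)) C) (hτ : t < Γ.τ) :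
    2 * ρ < opt A k z (S.points (S.window W t)) := by
  rcases h.timestamp with h0 | ⟨T, hT, hopt⟩
  · linarith
  · refine hopt.trans_le (hC.opt_mono (S.points_mono fun i hi => ?_))
    exact Finset.mem_filter.2 ⟨PointStream.mem_arrived.2
      (PointStream.lt_card_arrived.1 (hT i hi).1), hτ.trans_le (hT i hi).2⟩

/-- Expanding a solution for the elements of a sketch yields a solution for the window. -/
theorem Sketch.Valid.isSolution_expand (h : Γ.Valid S W A k z ρ r N (S.arrived t).card t)
    (hr : 0 ≤ r) (hτ : Γ.τ ≤ t) {C : Balls X k} (hC : IsSolution A z (S.points Γ.elems) C) :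
    IsSolution A z (S.points (S.window W t)) { C with radius := C.radius + 2 * r } := by
  have hr0 := hC.1
  have hcard := hC.2.2
  refine ⟨by simp only; linarith, hC.2.1, ?_⟩
  rw [S.countP_points] at hcard ⊢
  refine le_trans (Finset.card_le_card fun p hp => ?_) hcard
  rw [Finset.mem_filter] at hp ⊢
  obtain ⟨hpw, hpn⟩ := hp
  have hpn' : ¬ C.CoversWithin 0 (S.pt p) := by
    rintro ⟨j, hj⟩
    exact hpn ⟨j, by simp only; linarith⟩
  obtain ⟨hpa, hpt⟩ := Finset.mem_filter.1 hpw
  -- A stored element left uncovered is already an outlier of `C`. A saturated one is reached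
  -- through its mini-ball centre and a covered representative, at the cost of `2 * r`.
  rcases h.stored p (PointStream.lt_card_arrived.2 (PointStream.mem_arrived.1 hpa))
    (hτ.trans_lt hpt) hpt with hmem | ⟨b, hb, hpb, hbc, -⟩
  · exact ⟨hmem, hpn'⟩
  · exfalso
    have hw : ∃ w ∈ Γ.rep b, C.CoversWithin 0 (S.pt w) := by
      by_contra! hcon
      have := Finset.card_le_card (show Γ.rep b ⊆
        Γ.elems.filter (fun i => ¬ C.CoversWithin 0 (S.pt i)) from fun w hw =>
        Finset.mem_filter.2 ⟨Sketch.mem_elems.2 (Or.inl ⟨b, hb, hw⟩), hcon w hw⟩)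
      omega
    obtain ⟨w, hw, j, hj⟩ := hw
    refine hpn ⟨j, ?_⟩
    have h1 := dist_triangle4 (S.pt p) (S.pt b) (S.pt w) (C.center j)
    have h2 := h.close b hb w hw
    rw [dist_comm] at h2
    simp only
    linarith

end Valid

end

/-! ### Explicit constants and the choice of scale. -/

section

variable {X : Type u} [MetricSpace X] {k : ℕ} {S : PointStream X}

theorem DoublingDimLE.card_le_of_separated_of_le_one [Nonempty X] {d : ℝ} (h : DoublingDimLE X d)
    {ε ρ : ℝ} (hε : 0 < ε) (hε1 : ε ≤ 1) (hρ : 0 < ρ) (c : Fin k → X) (F : Finset ℕ)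
    (hF : ∀ i ∈ F, ∃ j, dist (S.pt i) (c j) ≤ (6 + ε) * ρ)
    (hsep : ∀ i ∈ F, ∀ i' ∈ F, i ≠ i' → ε * ρ < dist (S.pt i) (S.pt i')) :
    (F.card : ℝ) ≤ k * (28 / ε) ^ d := by
  obtain ⟨n, hn, hn'⟩ := exists_nat_pow_near (x := 14 / ε) (y := 2)
    ((one_le_div hε).2 (by linarith)) one_lt_two
  -- Balls of radius `(6 + ε) * ρ` lie in balls of radius `7 * ρ`, so `2 ^ (n + 1) > 14 / ε` makes
  -- the small balls have diameter below `ε * ρ`. Maximality of `n` costs the factor 2 that gives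
  -- `28 / ε`.
  have hpow : (2 : ℝ) ^ (n + 1) ≤ 28 / ε := by
    calc (2 : ℝ) ^ (n + 1) = 2 ^ n * 2 := pow_succ _ _
      _ ≤ 14 / ε * 2 := by gcongr
      _ = 28 / ε := by ring
  have hs : 2 * (7 * ρ / 2 ^ (n + 1)) ≤ ε * ρ := by
    rw [div_lt_iff₀ hε] at hn'
    rw [← mul_div_assoc, div_le_iff₀ (by positivity)]
    nlinarith
  have hcard := h.card_le_of_separated (n + 1) (by positivity : 0 < 7 * ρ) hs c S.pt F
    (fun i hi => (hF i hi).imp fun j hj => hj.trans (by nlinarith)) hsep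
  refine hcard.trans ?_
  have heq : ((2 : ℝ) ^ d) ^ (n + 1) = ((2 : ℝ) ^ (n + 1)) ^ d := by
    rw [← Real.rpow_natCast, ← Real.rpow_natCast, ← Real.rpow_mul zero_le_two,
      ← Real.rpow_mul zero_le_two, mul_comm]
  rw [heq]
  gcongr
  exact h.nonneg

/-- The sketches run with `ε / 2`, which turns `28` into `56`. The remaining constants come from `z
+ 2 ≤ 2 * (z + 1)` and `ε ^ d ≤ 1`. -/
theorem one_add_add_mul_le {d ε : ℝ} {k z : ℕ} (hd : 0 ≤ d) (hk : 1 ≤ k) (hε : 0 < ε)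
    (hε1 : ε ≤ 1) :
    1 + (z : ℝ) + k * (28 / (ε / 2)) ^ d * (z + 2)
      ≤ (1 + 2 * (56 : ℝ) ^ d) * (k * (z + 1) / ε ^ d) := by
  have h56 : 28 / (ε / 2) = 56 / ε := by field_simp; norm_num
  have hεd : 0 < ε ^ d := Real.rpow_pos_of_pos hε d
  have hεd1 : ε ^ d ≤ 1 := Real.rpow_le_one hε.le hε1 hd
  have hk' : (1 : ℝ) ≤ k := by exact_mod_cast hk
  have h1 : 1 + (z : ℝ) ≤ k * (z + 1) / ε ^ d := by
    rw [le_div_iff₀ hεd]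
    have hz : (0 : ℝ) ≤ z := Nat.cast_nonneg z
    calc (1 + (z : ℝ)) * ε ^ d ≤ (1 + z) * 1 := by gcongr
      _ = 1 * (z + 1) := by ring
      _ ≤ k * (z + 1) := by gcongr
  have h2 : (k : ℝ) * (28 / (ε / 2)) ^ d * (z + 2)
      ≤ 2 * (56 : ℝ) ^ d * (k * (z + 1) / ε ^ d) := by
    rw [h56, Real.div_rpow (by norm_num) hε.le]
    calc (k : ℝ) * (56 ^ d / ε ^ d) * (z + 2) ≤ k * (56 ^ d / ε ^ d) * (2 * (z + 1)) := by
          gcongr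
          linarith [(Nat.cast_nonneg z : (0 : ℝ) ≤ z)]
      _ = _ := by ring
  linarith

theorem totalStorage_le {L : ℕ} {Γ : ℕ → Sketch} {s : ℝ} (h : ∀ i, ((Γ i).storage : ℝ) ≤ s) :
    (totalStorage L Γ : ℝ) ≤ (L + 1) * s := by
  unfold totalStorage
  push_cast
  calc ∑ i ∈ Finset.range (L + 1), ((Γ i).storage : ℝ) ≤ ∑ _i ∈ Finset.range (L + 1), s :=
        Finset.sum_le_sum fun i _ => h i
    _ = _ := by simp

theorem lt_two_mul_rho_lastIndex {a b : ℝ} (ha : 0 < a) (hab : a ≤ b) :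
    b < 2 * rho a (lastIndex a b) := by
  have h1 : 0 < b / a := div_pos (ha.trans_le hab) ha
  have h2 := Nat.lt_floor_add_one (Real.logb 2 (b / a))
  rw [Real.logb_lt_iff_lt_rpow one_lt_two h1, div_lt_iff₀ ha] at h2
  have h3 : (2 : ℝ) ^ ((⌊Real.logb 2 (b / a)⌋₊ : ℝ) + 1) = 2 * 2 ^ ⌊Real.logb 2 (b / a)⌋₊ := by
    rw [Real.rpow_add_one two_ne_zero, Real.rpow_natCast, mul_comm]
  rw [h3] at h2
  unfold rho lastIndex
  linarith

theorem exists_findSome?_range {α : Type*} (f : ℕ → Option α) {n : ℕ}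
    (h : ∃ i < n, f i ≠ none) :
    ∃ i < n, ∃ a, f i = some a ∧ (List.range n).findSome? f = some a ∧ ∀ j < i, f j = none := by
  induction n with
  | zero => simp at h
  | succ n ih =>
    rw [List.range_succ, List.findSome?_append]
    by_cases hn : ∃ i < n, f i ≠ none
    · obtain ⟨i, hi, a, ha, hfind, hlt⟩ := ih hn
      exact ⟨i, by omega, a, ha, by rw [hfind]; rfl, hlt⟩
    · push Not at hn
      obtain ⟨i, hi, hne⟩ := h
      have hin : i = n := by
        by_contra hcon
        exact hne (hn i (by omega))
      subst hin
      obtain ⟨a, ha⟩ := Option.ne_none_iff_exists'.1 hne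
      have hnone : (List.range i).findSome? f = none := by
        rw [List.findSome?_eq_none_iff]
        intro j hj
        exact hn j (List.mem_range.1 hj)
      exact ⟨i, by omega, a, ha, by simp [hnone, ha], hn⟩

section Decision

variable {W : ℝ} {A : Set X} {z : ℕ} {ρ ε N t : ℝ} {Γ : Sketch}
  {solve : Multiset X → Balls X k}

theorem Sketch.Valid.lt_opt_of_tryToCover_eq_none {r : ℝ}
    (h : Γ.Valid S W A k z ρ r N (S.arrived t).card t) (ht : 0 ≤ t)
    (hsolve : ∀ Q, IsOptimal A z Q (solve Q)) (hnone : tryToCover S solve ρ ε t Γ = none) :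
    2 * ρ < opt A k z (S.points (S.window W t)) := by
  unfold tryToCover at hnone
  simp only [ite_eq_left_iff, reduceCtorEq, imp_false, not_not] at hnone
  have hsol := (hsolve (S.points (S.window W t))).1
  rcases hnone with hτ | hC
  · exact h.lt_opt_of_lt_timestamp ht hsol hτ
  · rw [(hsolve _).radius_eq] at hC
    exact hC.trans_le (hsol.opt_mono (S.points_mono h.elems_subset_window))

theorem Sketch.Valid.of_tryToCover_eq_some
    (h : Γ.Valid S W A k z ρ (ε * ρ) N (S.arrived t).card t) (hr : 0 ≤ ε * ρ)
    (hsolve : ∀ Q, IsOptimal A z Q (solve Q)) {C : Balls X k}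
    (hsome : tryToCover S solve ρ ε t Γ = some C) :
    IsSolution A z (S.points (S.window W t)) C ∧
      C.radius = (solve (S.points Γ.elems)).radius + 2 * ε * ρ := by
  unfold tryToCover at hsome
  simp only [Option.ite_none_left_eq_some, not_or, not_lt, Option.some.injEq] at hsome
  obtain ⟨⟨hτ, -⟩, rfl⟩ := hsome
  refine ⟨?_, rfl⟩
  have := h.isSolution_expand hr hτ (hsolve _).1
  rwa [← mul_assoc] at this

end Decision

end

end KCenter

end

/-! ### The main theorem. -/

theorem theorem1 (d : ℝ) :
    ∃ K : ℝ, 0 < K ∧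
      ∀ (X : Type u) [MetricSpace X] (_ : KCenter.DoublingDimLE X d)
        (A : Set X) (S : KCenter.PointStream X) (k z : ℕ) (W ε Δmin Δmax : ℝ)
        (_ : 1 ≤ k) (_ : 0 < W) (_ : 0 < ε) (_ : ε < 1) (_ : 0 < Δmin) (_ : Δmin ≤ Δmax)
        (_ : ∀ i : ℕ, (i : ℕ∞) < S.len → S.pt i ∈ A)
        (_ : ∀ x ∈ A, ∀ y ∈ A, x ≠ y → Δmin ≤ dist x y)
        (_ : ∀ i j : ℕ, (i : ℕ∞) < S.len → (j : ℕ∞) < S.len → dist (S.pt i) (S.pt j) ≤ Δmax)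
        (approx : Multiset X → KCenter.Balls X k)
        (_ : (∀ Q, KCenter.IsCharikarOutput A z Q (approx Q)) ∨
          (∀ Q, KCenter.IsApprox A z 3 Q (approx Q)))
        (solve : Multiset X → KCenter.Balls X k)
        (_ : ∀ Q, KCenter.IsOptimal A z Q (solve Q))
        (tb : KCenter.TieBreak) (t : ℝ) (_ : 0 ≤ t),
        (KCenter.totalStorage (KCenter.lastIndex Δmin Δmax)
            (KCenter.fullSketch S W z approx tb ε Δmin t) : ℝ)
          ≤ K * (k * (z + 1) / ε ^ d) * (1 + Real.logb 2 (Δmax / Δmin)) ∧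
        ∃ C : KCenter.Balls X k,
          KCenter.findApproximateCenters S solve ε Δmin t (KCenter.lastIndex Δmin Δmax)
            (KCenter.fullSketch S W z approx tb ε Δmin t) = some C ∧
          KCenter.IsSolution A z (S.points (S.window W t)) C ∧
          C.radius ≤ (1 + ε) * KCenter.opt A k z (S.points (S.window W t)) := by
  refine ⟨1 + 2 * (56 : ℝ) ^ d, by positivity, ?_⟩
  intro X _ hd A S k z W ε Δmin Δmax hk hW hε hε1 hmin hminmax hA hsep hmax approx happrox' solve
    hsolve tb t ht
  have happrox : ∀ Q, KCenter.IsApprox A z 3 Q (approx Q) :=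
    happrox'.elim (fun h Q => (h Q).isApprox) id
  have hne : Nonempty X := ⟨(solve 0).center ⟨0, hk⟩⟩
  have hρ : ∀ i, 0 < KCenter.rho Δmin i := fun i => by unfold KCenter.rho; positivity
  have hvalid : ∀ i, (KCenter.fullSketch S W z approx tb ε Δmin t i).Valid S W A k z
      (KCenter.rho Δmin i) (ε / 2 * KCenter.rho Δmin i) (k * (28 / (ε / 2)) ^ d)
      (S.arrived t).card t := fun i =>
    KCenter.valid_sketchAt happrox hk (hρ i).le (half_pos hε).le tb (by positivity)
      (fun c F hF hs => hd.card_le_of_separated_of_le_one (by positivity) (by linarith) (hρ i)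
        c F hF hs) hW t
  have hwin : ∀ i ∈ S.window W t, (i : ℕ∞) < S.len := fun i hi =>
    (KCenter.PointStream.mem_arrived.1 (Finset.mem_filter.1 hi).1).1
  have hpts : ∀ Q ⊆ S.window W t, ∀ x ∈ S.points Q, x ∈ A := by
    intro Q hQ x hx
    obtain ⟨i, hi, rfl⟩ := Multiset.mem_map.1 hx
    exact hA i (hwin i (hQ hi))
  constructor
  · have hlog : 0 ≤ Real.logb 2 (Δmax / Δmin) :=
      Real.logb_nonneg one_lt_two ((one_le_div hmin).2 hminmax)
    have hfloor : (KCenter.lastIndex Δmin Δmax : ℝ) ≤ Real.logb 2 (Δmax / Δmin) :=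
      Nat.floor_le hlog
    refine (KCenter.totalStorage_le fun i => ((hvalid i).storage_le.trans
      (KCenter.one_add_add_mul_le hd.nonneg hk hε hε1.le))).trans ?_
    rw [mul_comm]
    exact mul_le_mul_of_nonneg_left (by linarith) (by positivity)
  · set P := S.points (S.window W t) with hP
    have hopt0 : 0 ≤ KCenter.opt A k z P := KCenter.opt_nonneg _ _ _ _
    -- One ball of radius `Δmax` around any window point covers the window.
    have hoptmax : KCenter.opt A k z P ≤ Δmax := by
      rcases (S.window W t).eq_empty_or_nonempty with h0 | ⟨i, hi⟩
      · have : P = 0 := by rw [hP, h0]; rfl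
        rw [this, KCenter.opt_zero ((hsolve 0).1.2.1 ⟨0, hk⟩)]
        linarith
      · refine KCenter.opt_le_of_dist_le hk (by linarith) (hA i (hwin i hi)) fun x hx => ?_
        obtain ⟨j, hj, rfl⟩ := Multiset.mem_map.1 hx
        exact hmax j i (hwin j hj) (hwin i hi)
    obtain ⟨i, hi, C, hC, hfind, hnone⟩ := KCenter.exists_findSome?_range
      (fun i => KCenter.tryToCover S solve (KCenter.rho Δmin i) (ε / 2) t
        (KCenter.fullSketch S W z approx tb ε Δmin t i))
      (n := KCenter.lastIndex Δmin Δmax + 1)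
      ⟨KCenter.lastIndex Δmin Δmax, Nat.lt_succ_self _, fun h0 => by
        have h1 := (hvalid _).lt_opt_of_tryToCover_eq_none ht hsolve h0
        have h2 := KCenter.lt_two_mul_rho_lastIndex hmin hminmax
        linarith⟩
    have hρi := hρ i
    obtain ⟨hsol, hrad⟩ := (hvalid i).of_tryToCover_eq_some (by positivity) hsolve hC
    have hsub := (hvalid i).elems_subset_window
    have hopt := hsolve (S.points (KCenter.fullSketch S W z approx tb ε Δmin t i).elems)
    have hle := hsol.opt_mono (S.points_mono hsub)
    rw [← hopt.radius_eq] at hle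
    refine ⟨if C.radius < Δmin then { C with radius := 0 } else C, ?_, ?_⟩
    · rw [KCenter.findApproximateCenters, hfind]; rfl
    · split_ifs with hlt
      · exact ⟨hsol.shrink hsep (hpts _ subset_rfl) hlt, by simp only; positivity⟩
      · refine ⟨hsol, ?_⟩
        have hρle : KCenter.rho Δmin i ≤ KCenter.opt A k z P := by
          -- At scale 0 there is no earlier NO. If the solution for the stored elements has radius
          -- 0, the reported radius is `ε * Δmin < Δmin`, which is the shrinking case already
          -- treated; otherwise the optimum is at least `Δmin`.
          rcases i with _ | i
          · have h0 : KCenter.rho Δmin 0 = Δmin := by simp [KCenter.rho]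
            rw [h0] at hrad ⊢
            rcases hopt.radius_eq_zero_or_le hsep (hpts _ hsub) with h | h
            · rw [h] at hrad
              nlinarith
            · linarith
          · have h1 := (hvalid i).lt_opt_of_tryToCover_eq_none ht hsolve (hnone i (by omega))
            have h2 : KCenter.rho Δmin (i + 1) = 2 * KCenter.rho Δmin i := by
              simp only [KCenter.rho, pow_succ]; ring
            linarith
        rw [hrad]
        nlinarith
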